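/- **Setting.** Let $E,H$ be finite-dimensional real vector spaces with duals $E^*,H^*$, and let $K\subset E$ be a regular cone (closed, convex, pointed, with nonempty interior) with dual cone $K^*$. Let $F$ be a $\nu$-normal barrier for $K$: $F$ is $C^3$ and convex on $\operatorname{int}K$, tends to $+\infty$ at the boundary of $K$, is self-concordant, $|\nabla^3F(x)[h,h,h]|\le 2\langle\nabla^2F(x)h,h\rangle^{3/2}$, and satisfies $F(\tau x)=F(x)-\nu\ln\tau$ for $\tau>0$. Let $F_*(s)=\max_{x\in\operatorname{int}K}\{-\langle s,x\rangle-F(x)\}$ be the dual barrier. Assume that $F_*$ has negative curvature: $\nabla^3F_*(s)[h]\preceq0$ for all $s\in\operatorname{int}K^*$ and $h\in K^*$. Let $A:E\to H^*$ be linear and surjective, $b\in H^*$, $c\in E^*$, and consider $$\min\{\langle c,x\rangle:\ Ax=b,\ x\in K\},\qquad \max\{\langle b,y\rangle:\ y\in Q\},\quad Q=\{y\in H:\ s(y):=c-A^*y\in K^*\}.$$ Assume strict feasibility: there are $x_0\in\operatorname{int}K$ with $Ax_0=b$ and $y_0\in H$ with $s(y_0)\in\operatorname{int}K^*$. Let $(x_\mu,s_\mu,y_\mu)$,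 $\mu>0$, be the central path: $Ax_\mu=b$, $c+\mu\nabla F(x_\mu)=A^*y_\mu$, $s_\mu=-\mu\nabla F(x_\mu)$, $x_\mu\in\operatorname{int}K$. Put $B=\nabla^2F(x_1)$ (the point with $\mu=1$), $G=AB^{-1}A^*$, $\|x\|_B=\langle Bx,x\rangle^{1/2}$, $\|y\|_G=\langle Gy,y\rangle^{1/2}$. Let $y_*$ be a dual optimal solution and $s_*=s(y_*)$. Assume that for some constants $\gamma_d>0$ and $\sigma_d$ $$\langle b,y_*\rangle-\langle b,y\rangle\ \ge\ \gamma_d\|y-y_*\|_G\quad(y\in Q),\qquad \|\nabla^2F_*(s_\mu)s_*\|_B\le\sigma_d\quad(0<\mu\le1).$$ **Method.** Let $f(y)=F_*(s(y))$ on $\operatorname{int}Q$, $\|h\|_y=\langle\nabla^2f(y)h,h\rangle^{1/2}$ for $h\in H$, $\|g\|_y=\langle g,[\nabla^2f(y)]^{-1}g\rangle^{1/2}$ for $g\in H^*$, $v(y)=[\nabla^2f(y)]^{-1}\nabla f(y)$, $\bar\alpha(y)=\max\{\alpha\ge0:\ y+\alpha v(y)\in Q\}$, and $$\mathcal N(\mu,\beta)=\{y\in\operatorname{int}Q:\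 \|\nabla f(y)-\tfrac1\mu b\|_y\le\beta\},\qquad \xi_{\bar\alpha}(\alpha)=1+\frac{\alpha\bar\alpha}{\bar\alpha-\alpha},$$ $$\eta_{\bar\alpha}(\alpha)=\begin{cases}2\alpha,&\alpha<\bar\alpha/3,\\(\alpha+\bar\alpha)/2,&\alpha\ge\bar\alpha/3,\end{cases}\qquad \sigma_{s}(h)=\min\{\rho\ge0:\ \rho s-h\in K^*\},$$ $$\Gamma_\mu(y,\alpha)=\bigl(1+\alpha\,\sigma_{s(y)}(-A^*v(y))\bigr)\,\bigl\|\nabla f(y+\alpha v(y))-\tfrac{1}{\mu}\xi_{\bar\alpha(y)}(\alpha)\,b\bigr\|_y,\qquad \beta'=\tfrac16.$$ The dual path-following method starts with $\mu_0=1$ and $y_0\in\mathcal N(1,\frac1{25})$. Iteration $k\ge0$: - a) compute $\bar\alpha_k=\bar\alpha(y_k)$ (the maximum is required to exist); - b) with $\alpha_{k,0}=\frac16\min\{1,1/\|v(y_k)\|_{y_k}\}$ and $\alpha_{k,i+1}=\eta_{\bar\alpha_k}(\alpha_{k,i})$, find an index $i_k$ at which the search for the step stops, that is, $\Gamma_{\mu_k}(y_k,\alpha_{k,i_k})\le\beta'<\Gamma_{\mu_k}(y_k,\alpha_{k,i_k+1})$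 (for example the maximal $i$ with $\Gamma_{\mu_k}(y_k,\alpha_{k,i})\le\beta'$); - c) set $\alpha_k=\alpha_{k,i_k}$, $p_k=y_k+\alpha_kv(y_k)$, $\mu_{k+1}=\mu_k/\xi_{\bar\alpha_k}(\alpha_k)$; - d) starting from $p_k$, find $y_{k+1}\in\mathcal N(\mu_{k+1},\mu_{k+1}/25)$ by finitely many steps of the Newton method (full or damped) for minimizing $f(y)-\langle b,y\rangle/\mu_{k+1}$. **Constants.** Put $$\kappa_1=\nu+\frac{\frac1{25}\left(\frac1{25}+\nu^{1/2}\right)}{1-\frac1{25}},\qquad \kappa_2=\frac{2}{\gamma_d}\Bigl(\sigma_d+\frac{6}{25}\nu^2\Bigr),\qquad \kappa=\kappa_1\kappa_2,$$ $$c_0=\kappa\nu^{1/2}+\frac{2\kappa_1}{\gamma_d}\Bigl[\sigma_d+\frac6{25}\nu^2+2\kappa\nu\,(1+2\nu^{1/2})\,\frac{1-\frac1{25}}{1-\frac2{25}}\Bigr],\qquad c_1=\frac{\beta'}{(1+2\nu^{1/2})\left(c_0+\frac{7}{9\cdot25}\right)}.$$ **Theorem.** Let $\mu_0,\dots,\mu_{k+1}$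 and $y_0,\dots,y_{k+1}$ be generated by the method. If $$\mu_k\ \le\ \frac{\beta'}{(1+2\nu^{1/2})\left(9c_0+\frac7{25}\right)},$$ then $$\mu_{k+1}\ \le\ \frac{9}{c_1^{1/2}}\,\mu_k^{3/2}.$$ -/

import Mathlib

open Set Filter Topology

noncomputable section

namespace DualPathFollowing

/-! ### Operators, norms and barriers on a finite-dimensional space and its dual -/

section General

variable {V : Type*} [NormedAddCommGroup V] [NormedSpace ℝ V]

/-- The gradient of a function, as an element of the dual space. -/
def grad (Φ : V → ℝ) (x : V) : StrongDual ℝ V := fderiv ℝ Φ x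

/-- The Hessian of a function, as an operator from the space to its dual. -/
def hess (Φ : V → ℝ) (x : V) : V →L[ℝ] StrongDual ℝ V := fderiv ℝ (fderiv ℝ Φ) x

/-- The third differential of a function along three directions. -/
def third (Φ : V → ℝ) (x h₁ h₂ h₃ : V) : ℝ := iteratedFDeriv ℝ 3 Φ x ![h₁, h₂, h₃]

/-- `‖x‖_M = ⟨M x, x⟩^{1/2}`. -/
def opNorm (M : V →L[ℝ] StrongDual ℝ V) (x : V) : ℝ := √(M x x)

/-- `‖s‖_M = ⟨s, M⁻¹ s⟩^{1/2}`, the norm on the dual space given by `M`. -/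
def opDualNorm (M : V →L[ℝ] StrongDual ℝ V) (s : StrongDual ℝ V) : ℝ := √(s (M.inverse s))

/-- A regular cone: a closed convex cone (a `ProperCone`) that is pointed and has nonempty
interior. -/
structure IsRegularCone (K : ProperCone ℝ V) : Prop where
  pointed : ∀ x ∈ K, -x ∈ K → x = 0
  solid : (interior (K : Set V)).Nonempty

/-- A `ν`-normal barrier for the cone `K`: a self-concordant, `ν`-logarithmically homogeneous
function on `int K` which tends to infinity at the boundary of `K`. -/
structure IsNormalBarrier (K : Set V) (Φ : V → ℝ) (ν : ℝ) : Prop where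
  smooth : ContDiffOn ℝ 3 Φ (interior K)
  hess_nonneg : ∀ x ∈ interior K, ∀ h : V, 0 ≤ hess Φ x h h
  self_concordant : ∀ x ∈ interior K, ∀ h : V,
    |third Φ x h h h| ≤ 2 * (hess Φ x h h) ^ (3 / 2 : ℝ)
  boundary : ∀ x ∈ frontier K, Tendsto Φ (𝓝[interior K] x) atTop
  log_homogeneous : ∀ x ∈ interior K, ∀ τ : ℝ, 0 < τ → Φ (τ • x) = Φ x - ν * Real.log τ

/-- Negative curvature of `Φ` on `int K`: `∇³Φ(x)[h] ⪯ 0` for `x ∈ int K` and `h ∈ K`. -/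
def HasNegativeCurvature (K : Set V) (Φ : V → ℝ) : Prop :=
  ∀ x ∈ interior K, ∀ h ∈ K, ∀ u : V, third Φ x h u u ≤ 0

/-- The dual cone. -/
def dualCone (K : Set V) : Set (StrongDual ℝ V) := {s | ∀ x ∈ K, 0 ≤ s x}

/-- The dual barrier `F_*(s) = max_{x ∈ int K} (-⟨s, x⟩ - F(x))`. -/
def dualBarrier (K : Set V) (F : V → ℝ) (s : StrongDual ℝ V) : ℝ :=
  ⨆ x : interior K, (-(s x) - F x)

/-- The canonical identification of the bidual of a finite-dimensional space with the space. -/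
def fromBidual : StrongDual ℝ (StrongDual ℝ V) →L[ℝ] V :=
  (NormedSpace.inclusionInDoubleDual ℝ V).inverse

/-- `σ_x(h) = min {ρ ≥ 0 : ρ x - h ∈ K}`. -/
def coneMeasure (K : Set V) (x h : V) : ℝ := sInf {ρ : ℝ | 0 ≤ ρ ∧ ρ • x - h ∈ K}

end General

/-! ### The primal-dual conic problem -/

/-- Data of the problem `min {⟨c, x⟩ : A x = b, x ∈ K}` with a function `F` on `K` and
a parameter `ν`; here `A : E → H^*`. -/
structure ConicProblem (E H : Type*) [NormedAddCommGroup E] [NormedSpace ℝ E]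
    [NormedAddCommGroup H] [NormedSpace ℝ H] where
  K : ProperCone ℝ E
  F : E → ℝ
  ν : ℝ
  A : E →L[ℝ] StrongDual ℝ H
  b : StrongDual ℝ H
  c : StrongDual ℝ E

namespace ConicProblem

variable {E H : Type*} [NormedAddCommGroup E] [NormedSpace ℝ E]
  [NormedAddCommGroup H] [NormedSpace ℝ H] (P : ConicProblem E H)

/-- The dual cone `K^*`. -/
def Kd : Set (StrongDual ℝ E) := dualCone (P.K : Set E)

/-- The dual barrier `F_*`. -/
def Fd : StrongDual ℝ E → ℝ := dualBarrier (P.K : Set E) P.F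

/-- The adjoint `A^* : H → E^*`. -/
def Aadj : H →L[ℝ] StrongDual ℝ E := P.A.flip

/-- The dual slack `s(y) = c - A^* y`. -/
def slack (y : H) : StrongDual ℝ E := P.c - P.Aadj y

/-- The dual feasible set `Q = {y : c - A^* y ∈ K^*}`. -/
def Q : Set H := {y | P.slack y ∈ P.Kd}

/-- Strict primal and dual feasibility. -/
def StrictlyFeasible : Prop :=
  (∃ x ∈ interior (P.K : Set E), P.A x = P.b) ∧ ∃ y : H, P.slack y ∈ interior P.Kd

/-- `y` maximizes `⟨b, y⟩` over `Q`. -/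
def IsDualOptimal (y : H) : Prop := y ∈ P.Q ∧ ∀ z ∈ P.Q, P.b z ≤ P.b y

/-- `z = (x, s, y)` is the point of the primal-dual central path with parameter `μ`. -/
def IsCentral (μ : ℝ) (z : E × StrongDual ℝ E × H) : Prop :=
  z.1 ∈ interior (P.K : Set E) ∧ P.A z.1 = P.b ∧
    P.c + μ • grad P.F z.1 = P.Aadj z.2.2 ∧ z.2.1 = -(μ • grad P.F z.1)

/-- The primal-dual central path `μ ↦ (x_μ, s_μ, y_μ)`. -/
def centralPath (μ : ℝ) : E × StrongDual ℝ E × H := Classical.epsilon (P.IsCentral μ)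

/-- `B = ∇²F(x_1)`, the Hessian at the central point with `μ = 1`. -/
def B : E →L[ℝ] StrongDual ℝ E := hess P.F (P.centralPath 1).1

/-- `G = A B⁻¹ A^*`. -/
def G : H →L[ℝ] StrongDual ℝ H := P.A.comp (P.B.inverse.comp P.Aadj)

/-- The dual problem has the sharp optimal solution `ystar`, with constant `γd`. -/
def SharpDualMaximum (ystar : H) (γd : ℝ) : Prop :=
  0 < γd ∧ ∀ y ∈ P.Q, γd * opNorm P.G (y - ystar) ≤ P.b ystar - P.b y

/-- `‖∇²F_*(s_μ) s_*‖_B ≤ σd` for all `μ ∈ (0, 1]`, where `s_* = s(ystar)`. -/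
def BoundedHessianAlongPath (ystar : H) (σd : ℝ) : Prop :=
  ∀ μ : ℝ, 0 < μ → μ ≤ 1 →
    opNorm P.B (fromBidual (hess P.Fd (P.centralPath μ).2.1 (P.slack ystar))) ≤ σd

/-! ### The dual path-following method -/

/-- The barrier `f(y) = F_*(c - A^* y)` of the set `Q`. -/
def f (y : H) : ℝ := P.Fd (P.slack y)

/-- The predictor direction `v(y) = [∇²f(y)]⁻¹ ∇f(y)`. -/
def v (y : H) : H := (hess P.f y).inverse (grad P.f y)

/-- The neighborhood `N(μ, β) = {y ∈ int Q : ‖∇f(y) - b/μ‖_y ≤ β}` of the central path. -/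
def nbhd (μ β : ℝ) : Set H :=
  {y | y ∈ interior P.Q ∧ opDualNorm (hess P.f y) (grad P.f y - (1 / μ) • P.b) ≤ β}

/-- `abar` is the maximal feasible step along `v(y)`. -/
def IsMaxStep (y : H) (abar : ℝ) : Prop :=
  IsGreatest {α : ℝ | 0 ≤ α ∧ y + α • P.v y ∈ P.Q} abar

end ConicProblem

/-- `ξ_{abar}(α) = 1 + α abar / (abar - α)`. -/
def xi (abar α : ℝ) : ℝ := 1 + α * abar / (abar - α)

/-- The step length update: `2 α` for `α < abar / 3`, and `(α + abar) / 2` otherwise. -/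
def eta (abar α : ℝ) : ℝ := if α < abar / 3 then 2 * α else (α + abar) / 2

/-- The tolerance for the proximity measure. -/
def betaTol : ℝ := 1 / 6

namespace ConicProblem

variable {E H : Type*} [NormedAddCommGroup E] [NormedSpace ℝ E]
  [NormedAddCommGroup H] [NormedSpace ℝ H] (P : ConicProblem E H)

/-- The proximity measure
`Γ_μ(y, α) = (1 + α σ_{s(y)}(-A^* v(y))) ‖∇f(y + α v(y)) - (ξ_{abar}(α) / μ) b‖_y`. -/
def Gam (abar μ : ℝ) (y : H) (α : ℝ) : ℝ :=
  (1 + α * coneMeasure P.Kd (P.slack y) (-(P.Aadj (P.v y)))) *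
    opDualNorm (hess P.f y) (grad P.f (y + α • P.v y) - (xi abar α / μ) • P.b)

/-- The trial step lengths `α_0 = (1/6) min {1, 1/‖v(y)‖_y}`, `α_{i+1} = η_{abar}(α_i)`. -/
def trial (abar : ℝ) (y : H) (i : ℕ) : ℝ :=
  (eta abar)^[i] (1 / 6 * min 1 (1 / opNorm (hess P.f y) (P.v y)))

/-- `y'` is obtained from `p` by finitely many steps of the Newton method, full or damped, for
minimizing `f(y) - ⟨b, y⟩/μ`. -/
def NewtonReaches (μ : ℝ) (p y' : H) : Prop :=
  ∃ (m : ℕ) (z : ℕ → H), z 0 = p ∧ z m = y' ∧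
    ∀ j < m, z j ∈ interior P.Q ∧ ∃ t : ℝ, 0 < t ∧ t ≤ 1 ∧
      z (j + 1) = z j - t • (hess P.f (z j)).inverse (grad P.f (z j) - (1 / μ) • P.b)

/-- One iteration of the method, from `(μ, y)` to `(μ', y')`. The predictor step search stops at
an accepted trial step whose successor is rejected; this holds for the largest `i` such that the
`i`-th trial step is accepted, and also for the index at which a sequential search stops. -/
def Iteration (μ : ℝ) (y : H) (μ' : ℝ) (y' : H) : Prop :=
  ∃ (abar : ℝ) (i : ℕ), P.IsMaxStep y abar ∧
    P.Gam abar μ y (P.trial abar y i) ≤ betaTol ∧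
    betaTol < P.Gam abar μ y (P.trial abar y (i + 1)) ∧
    μ' = μ / xi abar (P.trial abar y i) ∧
    P.NewtonReaches μ' (y + P.trial abar y i • P.v y) y' ∧
    y' ∈ P.nbhd μ' (μ' / 25)

/-- `(μ_j)` and `(y_j)` are generated by the method, started at `μ_0 = 1`, up to and including
iteration `k` (which produces `μ_{k+1}` and `y_{k+1}`). -/
def GeneratedUpTo (k : ℕ) (μ : ℕ → ℝ) (y : ℕ → H) : Prop :=
  μ 0 = 1 ∧ y 0 ∈ P.nbhd 1 (1 / 25) ∧
    ∀ j ≤ k, P.Iteration (μ j) (y j) (μ (j + 1)) (y (j + 1))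

end ConicProblem

/-! ### The constants -/

/-- `κ₁`. -/
def kappa1 (ν : ℝ) : ℝ := ν + (1 / 25 * (1 / 25 + √ν)) / (1 - 1 / 25)

/-- `κ₂`. -/
def kappa2 (ν γd σd : ℝ) : ℝ := 2 / γd * (σd + 6 / 25 * ν ^ 2)

/-- `κ = κ₁ κ₂`. -/
def kappa (ν γd σd : ℝ) : ℝ := kappa1 ν * kappa2 ν γd σd

/-- `c₀`. -/
def c0 (ν γd σd : ℝ) : ℝ :=
  kappa ν γd σd * √ν + 2 * kappa1 ν / γd *
    (σd + 6 / 25 * ν ^ 2 +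
      2 * kappa ν γd σd * ν * (1 + 2 * √ν) * ((1 - 1 / 25) / (1 - 2 / 25)))

/-- `c₁`. -/
def c1 (ν γd σd : ℝ) : ℝ := betaTol / ((1 + 2 * √ν) * (c0 ν γd σd + 7 / (9 * 25)))

/-- The threshold for the penalty parameter. -/
def threshold (ν γd σd : ℝ) : ℝ := betaTol / ((1 + 2 * √ν) * (9 * c0 ν γd σd + 7 / 25))

end DualPathFollowing

end

/-! Near a sharp dual optimum the local barrier metric dominates the fixed metric `G` with a factor
of order 1/μ. For y in N(μ, μ/25) the optimality gap is at most κ₁μ (`gap_le`). Every h in the unit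
local ball gives two feasible points y ± h, so sharpness yields ‖h‖_G ≤ (κ₁/γ_d) μ ‖h‖_y
(`opNorm_G_le`). The error q = y + v - y_* of the full predictor step satisfies ∇²f(y) q = A
∇²F_*(s(y)) s_*, and the size of ∇²F_*(s(y)) s_* is controlled by σ_d. Hence ‖q‖_y ≤ κμ/2
(`opNorm_predictor_sub_le`), and the maximal step `abar` differs from 1 by O(μ)
(`abs_maxStep_sub_one_le`).

For a partial step, s(y + αv) is a positive multiple of s + τ s̄, where s̄ is the slack at the end
of the maximal step. By homogeneity ∇f(y + αv) = θ(∇f(y) - e) with θ close to ξ. The error e is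
controlled by negative curvature: -∇F_* decreases in the cone order along K^*, and never faster than
at its initial rate, which is given by ∇²F_*(s) s̄ with s̄ close to s_*. The outcome is Γ_μ(y, α) ≤
(1 + 2√ν) μ (1.1 c₀ ξ² + ξ/25) (`Gam_le`).

A rejected trial step therefore has ξ at least of order μ^{-1/2}. One update of the step multiplies
ξ by at most 4 (`xi_eta_le`), so the accepted step before it also has ξ of that order, and μ/ξ is
O(μ^{3/2}) (`iteration_le`).

All facts about F_* come from F through the map s ↦ -∇F_*(s) (`primalPoint`). Self-concordance is
used only for F; comparisons of Hessians of F_* rest on negative curvature. -/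

noncomputable section

namespace DualPathFollowing

/-! ### Positive semidefinite forms -/

section Forms

variable {V : Type*} [NormedAddCommGroup V] [NormedSpace ℝ V]

/-- A symmetric positive semidefinite operator from a space to its dual. -/
structure IsPSD (M : V →L[ℝ] StrongDual ℝ V) : Prop where
  symm : ∀ u w, M u w = M w u
  nonneg : ∀ u, 0 ≤ M u u

variable {M N : V →L[ℝ] StrongDual ℝ V}

lemma opNorm_nonneg (M : V →L[ℝ] StrongDual ℝ V) (u : V) : 0 ≤ opNorm M u := Real.sqrt_nonneg _

lemma IsPSD.sq_opNorm (hM : IsPSD M) (u : V) : opNorm M u ^ 2 = M u u :=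
  Real.sq_sqrt (hM.nonneg u)

lemma opNorm_smul (M : V →L[ℝ] StrongDual ℝ V) (c : ℝ) (u : V) :
    opNorm M (c • u) = |c| * opNorm M u := by
  simp only [opNorm, map_smul, smul_apply, smul_eq_mul]
  rw [← mul_assoc, Real.sqrt_mul (mul_self_nonneg c), Real.sqrt_mul_self_eq_abs]

lemma opNorm_neg (M : V →L[ℝ] StrongDual ℝ V) (u : V) : opNorm M (-u) = opNorm M u := by
  simp [opNorm]

lemma IsPSD.sq_apply_le (hM : IsPSD M) (u w : V) : M u w ^ 2 ≤ M u u * M w w := by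
  have h : ∀ t : ℝ, 0 ≤ M w w * (t * t) + 2 * M u w * t + M u u := fun t => by
    have := hM.nonneg (u + t • w)
    simp only [map_add, map_smul, add_apply, smul_apply,
      smul_eq_mul, hM.symm w u] at this
    linarith
  have := discrim_le_zero h
  rw [discrim] at this
  nlinarith

lemma IsPSD.abs_apply_le (hM : IsPSD M) (u w : V) : |M u w| ≤ opNorm M u * opNorm M w := by
  rw [opNorm, opNorm, ← Real.sqrt_mul (hM.nonneg u)]
  exact Real.abs_le_sqrt (hM.sq_apply_le u w)

lemma IsPSD.apply_le (hM : IsPSD M) (u w : V) : M u w ≤ opNorm M u * opNorm M w :=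
  (le_abs_self _).trans (hM.abs_apply_le u w)

lemma IsPSD.opNorm_add_le (hM : IsPSD M) (u w : V) :
    opNorm M (u + w) ≤ opNorm M u + opNorm M w := by
  refine Real.sqrt_le_iff.2 ⟨add_nonneg (opNorm_nonneg _ _) (opNorm_nonneg _ _), ?_⟩
  have := hM.apply_le u w
  simp only [map_add, add_apply, hM.symm w u]
  nlinarith [hM.sq_opNorm u, hM.sq_opNorm w]

lemma IsPSD.opNorm_sub_le (hM : IsPSD M) (u w : V) :
    opNorm M (u - w) ≤ opNorm M u + opNorm M w := by
  simpa [sub_eq_add_neg, opNorm_neg] using hM.opNorm_add_le u (-w)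

/-- A linear bound on the unit ball extends by homogeneity. -/
lemma le_mul_opNorm (M : V →L[ℝ] StrongDual ℝ V) {φ : V → ℝ} {C : ℝ}
    (hφ : ∀ (c : ℝ) u, 0 ≤ c → φ (c • u) = c * φ u)
    (h1 : ∀ u, opNorm M u ≤ 1 → φ u ≤ C) (u : V) : φ u ≤ C * opNorm M u := by
  rcases (opNorm_nonneg M u).eq_or_lt with h0 | h0
  · rw [← h0, mul_zero]
    by_contra! hc
    -- If the seminorm of u vanishes, the whole ray through u lies in the unit ball, so a positive φ
    -- u would be unbounded there.
    have hb : ∀ t : ℝ, 0 ≤ t → t * φ u ≤ C := fun t ht => by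
      rw [← hφ t u ht]
      exact h1 _ (by rw [opNorm_smul, ← h0]; simp)
    have := hb ((|C| + 1) / φ u) (by positivity)
    rw [div_mul_cancel₀ _ hc.ne'] at this
    linarith [le_abs_self C]
  · have := h1 ((opNorm M u)⁻¹ • u) (by
      rw [opNorm_smul, abs_of_pos (inv_pos.2 h0), inv_mul_cancel₀ h0.ne'])
    rw [hφ _ _ (inv_pos.2 h0).le, inv_mul_le_iff₀ h0] at this
    linarith

/-- A symmetric form dominated by `ρ M` satisfies a Cauchy-Schwarz inequality. -/
lemma IsPSD.abs_sub_apply_le {L : V →L[ℝ] StrongDual ℝ V} (hM : IsPSD M) (hN : IsPSD N)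
    (hL : IsPSD L) {ρ : ℝ} (hρ : 0 ≤ ρ)
    (h : ∀ u, |N u u - L u u| ≤ ρ * M u u) (u w : V) :
    |N u w - L u w| ≤ ρ * (opNorm M u * opNorm M w) := by
  -- Both ρM ± (N - L) are positive semidefinite. Evaluating them at u ± w polarizes the diagonal
  -- bound for unit vectors; homogeneity in each variable does the rest.
  have hP : IsPSD (ρ • M + (N - L)) := ⟨fun u w => by simp [hM.symm u, hN.symm u, hL.symm u],
    fun u => by simpa using by linarith [(abs_le.1 (h u)).1]⟩
  have hP' : IsPSD (ρ • M - (N - L)) := ⟨fun u w => by simp [hM.symm u, hN.symm u, hL.symm u],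
    fun u => by simpa using by linarith [(abs_le.1 (h u)).2]⟩
  have key : ∀ u w : V, opNorm M u ≤ 1 → opNorm M w ≤ 1 → |N u w - L u w| ≤ ρ := fun u w hu hw => by
    have e1 := hP.nonneg (u + w)
    have e2 := hP'.nonneg (u - w)
    have e3 := hP.nonneg (u - w)
    have e4 := hP'.nonneg (u + w)
    have hu' : M u u ≤ 1 := by rw [← hM.sq_opNorm]; nlinarith [opNorm_nonneg M u]
    have hw' : M w w ≤ 1 := by rw [← hM.sq_opNorm]; nlinarith [opNorm_nonneg M w]
    simp only [map_add, map_sub, add_apply, sub_apply,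
      smul_apply, smul_eq_mul, hM.symm w u, hN.symm w u, hL.symm w u]
      at e1 e2 e3 e4
    rw [abs_le]
    constructor <;> nlinarith
  have k1 : ∀ u : V, opNorm M u ≤ 1 → ∀ w, |N u w - L u w| ≤ ρ * opNorm M w := fun u hu w =>
    le_mul_opNorm M (φ := fun w => |N u w - L u w|)
      (fun c w hc => by simp [← mul_sub, abs_mul, abs_of_nonneg hc]) (fun w hw => key u w hu hw) w
  have k2 := le_mul_opNorm M (φ := fun u => |N u w - L u w|) (C := ρ * opNorm M w)
      (fun c w hc => by simp [← mul_sub, abs_mul, abs_of_nonneg hc]) (fun u hu => k1 u hu w) u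
  linarith

variable [FiniteDimensional ℝ V]

lemma isInvertible_of_pos (hpos : ∀ u, u ≠ 0 → 0 < M u u) : M.IsInvertible := by
  have hinj : Function.Injective M := by
    rw [injective_iff_map_eq_zero]
    intro u hu
    by_contra hne
    have := hpos u hne
    simp [hu] at this
  have hfr : Module.finrank ℝ V = Module.finrank ℝ (StrongDual ℝ V) := by
    rw [← Subspace.dual_finrank_eq (K := ℝ) (V := V)]
    exact LinearEquiv.finrank_eq (LinearMap.toContinuousLinearMap (𝕜 := ℝ) (E := V) (F' := ℝ))
  exact ⟨(LinearEquiv.ofInjectiveOfFinrankEq (M : V →ₗ[ℝ] StrongDual ℝ V) hinj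
    hfr).toContinuousLinearEquiv, by ext; rfl⟩

lemma apply_inverse_of_pos (hpos : ∀ u, u ≠ 0 → 0 < M u u) (s : StrongDual ℝ V) :
    M (M.inverse s) = s :=
  ((isInvertible_of_pos hpos).inverse_apply_eq.1 rfl).symm

lemma inverse_apply_of_pos (hpos : ∀ u, u ≠ 0 → 0 < M u u) (u : V) : M.inverse (M u) = u :=
  (isInvertible_of_pos hpos).inverse_apply_eq.2 rfl

lemma IsPSD.abs_le_opDualNorm_mul (hM : IsPSD M) (hpos : ∀ u, u ≠ 0 → 0 < M u u)
    (g : StrongDual ℝ V) (h : V) : |g h| ≤ opDualNorm M g * opNorm M h := by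
  have := hM.abs_apply_le (M.inverse g) h
  rw [apply_inverse_of_pos hpos] at this
  convert! this using 2
  rw [opDualNorm, opNorm, apply_inverse_of_pos hpos]

/-- The test vector is M⁻¹g, whose norm equals the dual norm of g. This reduces the residual in Γ to
estimates along a single direction h. -/
lemma opDualNorm_le_of_forall (hpos : ∀ u, u ≠ 0 → 0 < M u u)
    {g : StrongDual ℝ V} {C : ℝ} (hC : 0 ≤ C) (h : ∀ h, g h ≤ C * opNorm M h) :
    opDualNorm M g ≤ C := by
  have h1 := h (M.inverse g)
  have h2 : opNorm M (M.inverse g) = opDualNorm M g := by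
    rw [opDualNorm, opNorm, apply_inverse_of_pos hpos]
  rw [h2] at h1
  have h0 : 0 ≤ opDualNorm M g := Real.sqrt_nonneg _
  by_contra! hc
  have h3 : 0 < g (M.inverse g) := Real.sqrt_pos.1 (lt_of_le_of_lt hC hc)
  have h4 : opDualNorm M g ^ 2 = g (M.inverse g) := Real.sq_sqrt h3.le
  nlinarith

end Forms

/-! ### Derivatives along lines -/

section Line

variable {V : Type*} [NormedAddCommGroup V] [NormedSpace ℝ V] {Φ : V → ℝ} {x : V}

lemma hasDerivAt_line (x h : V) (t : ℝ) : HasDerivAt (fun t : ℝ => x + t • h) h t := by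
  simpa using ((hasDerivAt_id t).smul_const h).const_add x

lemma hasFDerivAt_grad (hΦ : ContDiffAt ℝ 3 Φ x) : HasFDerivAt Φ (grad Φ x) x :=
  (hΦ.differentiableAt (by norm_num)).hasFDerivAt

lemma contDiffAt_grad (hΦ : ContDiffAt ℝ 3 Φ x) : ContDiffAt ℝ 2 (grad Φ) x :=
  hΦ.fderiv_right (m := 2) (by norm_num)

lemma hasFDerivAt_hess (hΦ : ContDiffAt ℝ 3 Φ x) : HasFDerivAt (grad Φ) (hess Φ x) x :=
  ((contDiffAt_grad hΦ).differentiableAt (by norm_num)).hasFDerivAt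

lemma contDiffAt_hess (hΦ : ContDiffAt ℝ 3 Φ x) : ContDiffAt ℝ 1 (hess Φ) x :=
  (contDiffAt_grad hΦ).fderiv_right (m := 1) (by norm_num)

lemma differentiableAt_hess (hΦ : ContDiffAt ℝ 3 Φ x) : DifferentiableAt ℝ (hess Φ) x :=
  (contDiffAt_hess hΦ).differentiableAt (by norm_num)

lemma third_eq_fderiv (hΦ : ContDiffAt ℝ 3 Φ x) (a b c : V) :
    third Φ x a b c = fderiv ℝ (hess Φ) x a b c := by
  rw [third, iteratedFDeriv_succ_apply_left]
  have hd : DifferentiableAt ℝ (iteratedFDeriv ℝ 2 Φ) x :=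
    hΦ.differentiableAt_iteratedFDeriv (by norm_num)
  have h1 : HasFDerivAt (fun z => iteratedFDeriv ℝ 2 Φ z ![b, c])
      ((ContinuousMultilinearMap.apply ℝ (fun _ : Fin 2 => V) ℝ ![b, c]).comp
        (fderiv ℝ (iteratedFDeriv ℝ 2 Φ) x)) x :=
    (ContinuousMultilinearMap.apply ℝ (fun _ : Fin 2 => V) ℝ ![b, c]).hasFDerivAt.comp x
      hd.hasFDerivAt
  have h2 : HasFDerivAt (fun z => hess Φ z b c)
      (((fderiv ℝ (hess Φ) x).flip b).flip c) x := by
    have e1 := ((differentiableAt_hess hΦ).hasFDerivAt.clm_apply (hasFDerivAt_const b x)).clm_apply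
      (hasFDerivAt_const c x)
    convert! e1 using 1
    ext z
    simp
  have h3 : (fun z => iteratedFDeriv ℝ 2 Φ z ![b, c]) = fun z => hess Φ z b c := by
    ext z
    simp [iteratedFDeriv_two_apply, hess]
  rw [h3] at h1
  have := congrArg (fun L => L a) (h1.unique h2)
  simpa [Matrix.vecTail] using this

lemma hess_symm (hΦ : ContDiffAt ℝ 3 Φ x) (u w : V) : hess Φ x u w = hess Φ x w u :=
  hΦ.isSymmSndFDerivAt (by simp; norm_num) u w

/-- Negative curvature speaks only of ∇³Φ[h, u, u]. The two swaps bring ∇³Φ[p, p, h] to that form.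
-/
lemma third_swap_right (hΦ : ContDiffAt ℝ 3 Φ x) (a b c : V) :
    third Φ x a b c = third Φ x a c b := by
  rw [third_eq_fderiv hΦ, third_eq_fderiv hΦ]
  have h2 : ∀ b c : V, HasFDerivAt (fun z => hess Φ z b c)
      (((fderiv ℝ (hess Φ) x).flip b).flip c) x := fun b c => by
    have e1 := ((differentiableAt_hess hΦ).hasFDerivAt.clm_apply (hasFDerivAt_const b x)).clm_apply
      (hasFDerivAt_const c x)
    convert! e1 using 1
    ext z
    simp
  have hev : ∀ᶠ z in 𝓝 x, hess Φ z b c = hess Φ z c b := by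
    filter_upwards [hΦ.eventually (by simp)] with z hz
    exact hess_symm hz b c
  have := congrArg (fun L => L a) ((h2 b c).unique ((h2 c b).congr_of_eventuallyEq hev))
  simpa using this

lemma third_swap_left (hΦ : ContDiffAt ℝ 3 Φ x) (a b c : V) :
    third Φ x a b c = third Φ x b a c := by
  rw [third_eq_fderiv hΦ, third_eq_fderiv hΦ]
  have := (contDiffAt_grad hΦ).isSymmSndFDerivAt (by simp) a b
  exact congrArg (fun L => L c) this

variable {h : V} {t : ℝ}

lemma hasDerivAt_line_apply (hΦ : ContDiffAt ℝ 3 Φ (x + t • h)) :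
    HasDerivAt (fun t : ℝ => Φ (x + t • h)) (grad Φ (x + t • h) h) t :=
  (hasFDerivAt_grad hΦ).comp_hasDerivAt t (hasDerivAt_line x h t)

lemma hasDerivAt_line_grad (hΦ : ContDiffAt ℝ 3 Φ (x + t • h)) (u : V) :
    HasDerivAt (fun t : ℝ => grad Φ (x + t • h) u) (hess Φ (x + t • h) h u) t := by
  have := (hasFDerivAt_hess hΦ).comp_hasDerivAt t (hasDerivAt_line x h t)
  simpa using this.clm_apply (hasDerivAt_const t u)

lemma hasDerivAt_line_hess (hΦ : ContDiffAt ℝ 3 Φ (x + t • h)) (u w : V) :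
    HasDerivAt (fun t : ℝ => hess Φ (x + t • h) u w) (third Φ (x + t • h) h u w) t := by
  have := HasFDerivAt.comp_hasDerivAt (l := hess Φ) t (differentiableAt_hess hΦ).hasFDerivAt
    (hasDerivAt_line x h t)
  rw [third_eq_fderiv hΦ]
  simpa using (this.clm_apply (hasDerivAt_const t u)).clm_apply (hasDerivAt_const t w)

end Line

/-! ### Self-concordance on a segment -/

/-- Self-concordance says exactly that g^{-1/2} is 1-Lipschitz along a segment. The shift by ε
allows g to vanish. -/
lemma abs_inv_sqrt_sub_le {g g' : ℝ → ℝ} {T ε : ℝ} (hT : 0 ≤ T) (hε : 0 < ε)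
    (hg : ∀ t ∈ Icc 0 T, HasDerivAt g (g' t) t) (h0 : ∀ t ∈ Icc 0 T, 0 ≤ g t)
    (hsc : ∀ t ∈ Icc 0 T, |g' t| ≤ 2 * g t ^ (3 / 2 : ℝ)) :
    |(√(g T + ε))⁻¹ - (√(g 0 + ε))⁻¹| ≤ T := by
  have hder : ∀ t ∈ Icc 0 T, HasDerivWithinAt (fun t => (√(g t + ε))⁻¹)
      (-(g' t / (2 * √(g t + ε))) / √(g t + ε) ^ 2) (Icc 0 T) t := fun t ht => by
    have hp : 0 < g t + ε := by linarith [h0 t ht]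
    exact ((((hg t ht).add_const ε).sqrt hp.ne').inv (Real.sqrt_pos.2 hp).ne').hasDerivWithinAt
  have hbd : ∀ t ∈ Icc 0 T, ‖-(g' t / (2 * √(g t + ε))) / √(g t + ε) ^ 2‖ ≤ 1 := fun t ht => by
    have hp : 0 < g t + ε := by linarith [h0 t ht]
    have hs := Real.sqrt_pos.2 hp
    rw [neg_div, norm_neg, div_div, Real.norm_eq_abs, abs_div, abs_of_pos (by positivity :
      0 < 2 * √(g t + ε) * √(g t + ε) ^ 2), div_le_one (by positivity)]
    refine (hsc t ht).trans ?_
    have : g t ^ (3 / 2 : ℝ) ≤ (g t + ε) ^ (3 / 2 : ℝ) :=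
      Real.rpow_le_rpow (h0 t ht) (by linarith) (by norm_num)
    have e : (g t + ε) ^ (3 / 2 : ℝ) = √(g t + ε) * √(g t + ε) ^ 2 := by
      rw [Real.sq_sqrt hp.le, Real.sqrt_eq_rpow, ← Real.rpow_add_one hp.ne']
      norm_num
    rw [e] at this
    linarith
  have := (convex_Icc 0 T).norm_image_sub_le_of_norm_hasDerivWithin_le hder hbd
    (left_mem_Icc.2 hT) (right_mem_Icc.2 hT)
  simpa [abs_of_nonneg hT] using this

/-- The Lipschitz bound multiplied by both square roots; in this form it survives ε → 0 even where g
vanishes, which is needed before the Hessian is known to be definite. -/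
lemma abs_sqrt_sub_sqrt_le {g g' : ℝ → ℝ} {T : ℝ} (hT : 0 ≤ T)
    (hg : ∀ t ∈ Icc 0 T, HasDerivAt g (g' t) t) (h0 : ∀ t ∈ Icc 0 T, 0 ≤ g t)
    (hsc : ∀ t ∈ Icc 0 T, |g' t| ≤ 2 * g t ^ (3 / 2 : ℝ)) :
    |√(g 0) - √(g T)| ≤ T * (√(g 0) * √(g T)) := by
  have hε : ∀ ε > 0, |√(g 0 + ε) - √(g T + ε)| ≤ T * (√(g 0 + ε) * √(g T + ε)) := fun ε hε => by
    have h := abs_inv_sqrt_sub_le hT hε hg h0 hsc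
    have p0 : 0 < √(g 0 + ε) := Real.sqrt_pos.2 (by linarith [h0 0 (left_mem_Icc.2 hT)])
    have p1 : 0 < √(g T + ε) := Real.sqrt_pos.2 (by linarith [h0 T (right_mem_Icc.2 hT)])
    have e : √(g 0 + ε) - √(g T + ε) =
        ((√(g T + ε))⁻¹ - (√(g 0 + ε))⁻¹) * (√(g 0 + ε) * √(g T + ε)) := by
      field_simp
    rw [e, abs_mul, abs_of_pos (mul_pos p0 p1)]
    exact mul_le_mul_of_nonneg_right h (mul_pos p0 p1).le
  have c1 : Tendsto (fun ε : ℝ => |√(g 0 + ε) - √(g T + ε)|) (𝓝[>] 0)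
      (𝓝 |√(g 0) - √(g T)|) := by
    have : Continuous fun ε : ℝ => |√(g 0 + ε) - √(g T + ε)| := by fun_prop
    simpa using (this.tendsto 0).mono_left nhdsWithin_le_nhds
  have c2 : Tendsto (fun ε : ℝ => T * (√(g 0 + ε) * √(g T + ε))) (𝓝[>] 0)
      (𝓝 (T * (√(g 0) * √(g T)))) := by
    have : Continuous fun ε : ℝ => T * (√(g 0 + ε) * √(g T + ε)) := by fun_prop
    simpa using (this.tendsto 0).mono_left nhdsWithin_le_nhds
  exact le_of_tendsto_of_tendsto c1 c2 (eventually_nhdsWithin_of_forall hε)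

lemma monotoneOn_Ici_of_hasDerivAt {g g' : ℝ → ℝ} (hg : ∀ t, 0 ≤ t → HasDerivAt g (g' t) t)
    (h : ∀ t, 0 ≤ t → 0 ≤ g' t) : MonotoneOn g (Ici 0) :=
  monotoneOn_of_hasDerivWithinAt_nonneg (convex_Ici 0)
    (fun t ht => (hg t ht).continuousAt.continuousWithinAt)
    (fun t ht => (hg t (interior_subset ht)).hasDerivWithinAt)
    (fun t ht => h t (interior_subset ht))

lemma monotoneOn_Icc_of_hasDerivAt {g g' : ℝ → ℝ} {T : ℝ}
    (hg : ∀ t ∈ Icc 0 T, HasDerivAt g (g' t) t)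
    (h : ∀ t ∈ Icc 0 T, 0 ≤ g' t) : MonotoneOn g (Icc 0 T) :=
  monotoneOn_of_hasDerivWithinAt_nonneg (convex_Icc 0 T)
    (fun t ht => (hg t ht).continuousAt.continuousWithinAt)
    (fun t ht => (hg t (interior_subset ht)).hasDerivWithinAt)
    (fun t ht => h t (interior_subset ht))

/-! ### Cones -/

section Cone

variable {V : Type*} [NormedAddCommGroup V] [NormedSpace ℝ V]

/-- A convex cone, as a set. -/
structure IsCone (C : Set V) : Prop where
  add_mem : ∀ x ∈ C, ∀ y ∈ C, x + y ∈ C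
  smul_mem : ∀ c : ℝ, 0 ≤ c → ∀ x ∈ C, c • x ∈ C

namespace IsCone

variable {C : Set V} (hC : IsCone C)
include hC

lemma convex : Convex ℝ C := fun x hx y hy a b ha hb _ =>
  hC.add_mem _ (hC.smul_mem a ha x hx) _ (hC.smul_mem b hb y hy)

lemma add_mem_interior {x p : V} (hx : x ∈ interior C) (hp : p ∈ C) : x + p ∈ interior C := by
  have : (fun z => z + p) '' interior C ⊆ interior C := interior_maximal
    (by rintro _ ⟨z, hz, rfl⟩; exact hC.add_mem _ (interior_subset hz) _ hp)
    (isOpenMap_add_right p _ isOpen_interior)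
  exact this ⟨x, hx, rfl⟩

lemma smul_mem_interior {x : V} (hx : x ∈ interior C) {τ : ℝ} (hτ : 0 < τ) :
    τ • x ∈ interior C := by
  have : (fun z => τ • z) '' interior C ⊆ interior C := interior_maximal
    (by rintro _ ⟨z, hz, rfl⟩; exact hC.smul_mem _ hτ.le _ (interior_subset hz))
    (isOpenMap_smul₀ hτ.ne' _ isOpen_interior)
  exact this ⟨x, hx, rfl⟩

lemma add_smul_mem_interior {x p : V} (hx : x ∈ interior C) (hp : p ∈ C) {t : ℝ} (ht : 0 ≤ t) :
    x + t • p ∈ interior C :=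
  hC.add_mem_interior hx (hC.smul_mem t ht p hp)

end IsCone

lemma isCone_properCone (K : ProperCone ℝ V) : IsCone (K : Set V) :=
  ⟨fun _ hx _ hy => K.toSubmodule.add_mem hx hy, fun _ hc _ hx => K.smul_mem hx hc⟩

lemma isCone_dualCone (C : Set V) : IsCone (dualCone C) :=
  ⟨fun _ hs _ ht x hx => add_nonneg (hs x hx) (ht x hx),
    fun _ hc _ hs x hx => mul_nonneg hc (hs x hx)⟩

lemma exists_pos_mul_norm_le {C : Set V} {s : StrongDual ℝ V} (hs : s ∈ interior (dualCone C)) :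
    ∃ ε > 0, ∀ x ∈ C, ε * ‖x‖ ≤ s x := by
  obtain ⟨ε, hε, hball⟩ := Metric.isOpen_iff.1 isOpen_interior s hs
  refine ⟨ε / 2, by positivity, fun x hx => ?_⟩
  obtain ⟨g, hg, hgx⟩ := exists_dual_vector'' ℝ x
  rw [RCLike.ofReal_real_eq_id, id] at hgx
  have hmem : s - (ε / 2) • g ∈ dualCone C := interior_subset (hball (by
    rw [Metric.mem_ball, dist_eq_norm, sub_sub_cancel_left, norm_neg, norm_smul,
      Real.norm_of_nonneg (by positivity)]
    nlinarith))
  have := hmem x hx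
  simp only [sub_apply, smul_apply, smul_eq_mul, hgx] at this
  linarith

lemma mem_interior_dualCone_of_le {C : Set V} {s : StrongDual ℝ V} {ε : ℝ} (hε : 0 < ε)
    (h : ∀ x ∈ C, ε * ‖x‖ ≤ s x) : s ∈ interior (dualCone C) := by
  refine interior_maximal (s := dualCone C) (t := Metric.ball s ε) (fun u hu x hx => ?_)
    Metric.isOpen_ball (Metric.mem_ball_self hε)
  rw [Metric.mem_ball, dist_eq_norm] at hu
  have h1 := (abs_le.1 ((u - s).le_opNorm x)).1
  have h2 : ‖u - s‖ * ‖x‖ ≤ ε * ‖x‖ := mul_le_mul_of_nonneg_right hu.le (norm_nonneg x)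
  have := h x hx
  simp only [sub_apply] at h1
  linarith

end Cone

/-! ### Normal barriers -/

section Barrier

variable {E : Type*} [NormedAddCommGroup E] [NormedSpace ℝ E]
  {K : ProperCone ℝ E} {F : E → ℝ} {ν : ℝ}

namespace IsNormalBarrier

variable (hF : IsNormalBarrier (K : Set E) F ν)
include hF

lemma contDiffAt {x : E} (hx : x ∈ interior (K : Set E)) : ContDiffAt ℝ 3 F x :=
  hF.smooth.contDiffAt (isOpen_interior.mem_nhds hx)

lemma isPSD_hess {x : E} (hx : x ∈ interior (K : Set E)) : IsPSD (hess F x) :=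
  ⟨hess_symm (hF.contDiffAt hx), hF.hess_nonneg x hx⟩

lemma grad_le {x z : E} (hx : x ∈ interior (K : Set E)) (hz : z ∈ interior (K : Set E)) :
    F x + grad F x (z - x) ≤ F z := by
  have hmem : ∀ t ∈ Icc (0 : ℝ) 1, x + t • (z - x) ∈ interior (K : Set E) := fun t ht =>
    (isCone_properCone K).convex.interior.add_smul_sub_mem hx hz ht
  have hmono : MonotoneOn (fun t : ℝ => grad F (x + t • (z - x)) (z - x)) (Icc 0 1) :=
    monotoneOn_Icc_of_hasDerivAt (fun t ht => hasDerivAt_line_grad (hF.contDiffAt (hmem t ht)) _)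
      fun t ht => hF.hess_nonneg _ (hmem t ht) _
  have hmono2 : MonotoneOn (fun t : ℝ => F (x + t • (z - x)) - t * grad F x (z - x)) (Icc 0 1) :=
    monotoneOn_Icc_of_hasDerivAt (fun t ht =>
      (hasDerivAt_line_apply (hF.contDiffAt (hmem t ht))).sub ((hasDerivAt_id t).mul_const _))
      fun t ht => by
        have := hmono (left_mem_Icc.2 zero_le_one) ht ht.1
        simp only [zero_smul, add_zero] at this
        linarith
  have := hmono2 (left_mem_Icc.2 zero_le_one) (right_mem_Icc.2 zero_le_one) zero_le_one
  simp only [zero_smul, add_zero, one_smul, add_sub_cancel, zero_mul, sub_zero, one_mul] at this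
  linarith

lemma grad_smul {x : E} (hx : x ∈ interior (K : Set E)) {τ : ℝ} (hτ : 0 < τ) :
    grad F (τ • x) = τ⁻¹ • grad F x := by
  have h1 : HasFDerivAt (fun z => F (τ • z)) (τ • grad F (τ • x)) x := by
    have := (hasFDerivAt_grad (hF.contDiffAt ((isCone_properCone K).smul_mem_interior hx hτ))).comp
      x ((hasFDerivAt_id x).const_smul τ)
    convert! this using 1
    ext; simp
  have h2 : HasFDerivAt (fun z => F (τ • z)) (grad F x) x := by
    refine ((hasFDerivAt_grad (hF.contDiffAt hx)).sub_const (ν * Real.log τ)).congr_of_eventuallyEq ?_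
    filter_upwards [isOpen_interior.mem_nhds hx] with z hz
    exact hF.log_homogeneous z hz τ hτ
  rw [← h1.unique h2, smul_smul, inv_mul_cancel₀ hτ.ne', one_smul]

lemma grad_self {x : E} (hx : x ∈ interior (K : Set E)) : grad F x x = -ν := by
  have h1 : HasDerivAt (fun t : ℝ => F (x + t • x)) (grad F x x) 0 := by
    have := hasDerivAt_line_apply (Φ := F) (x := x) (h := x) (t := 0)
      (by simpa using hF.contDiffAt hx)
    simpa using this
  have h2 : HasDerivAt (fun t : ℝ => F (x + t • x)) (-ν) 0 := by
    have e : HasDerivAt (fun t : ℝ => F x - ν * Real.log (1 + t)) (-ν) 0 := by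
      have := (((((hasDerivAt_id (0 : ℝ)).const_add 1).log (by simp)).const_mul ν).const_sub (F x))
      simpa using this
    refine e.congr_of_eventuallyEq ?_
    filter_upwards [isOpen_Ioi.mem_nhds (show (0 : ℝ) ∈ Ioi (-1) by simp)] with t ht
    rw [← hF.log_homogeneous x hx (1 + t) (by rw [mem_Ioi] at ht; linarith), add_smul, one_smul]
  exact h1.unique h2

lemma hess_self {x : E} (hx : x ∈ interior (K : Set E)) (u : E) : hess F x x u = -grad F x u := by
  have h1 : HasDerivAt (fun t : ℝ => grad F (x + t • x) u) (hess F x x u) 0 := by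
    have := hasDerivAt_line_grad (Φ := F) (x := x) (h := x) (t := 0)
      (by simpa using hF.contDiffAt hx) u
    simpa using this
  have h2 : HasDerivAt (fun t : ℝ => grad F (x + t • x) u) (-grad F x u) 0 := by
    have e : HasDerivAt (fun t : ℝ => (1 + t)⁻¹ * grad F x u) (-grad F x u) 0 := by
      have := ((((hasDerivAt_id (0 : ℝ)).const_add 1).inv (by simp)).mul_const (grad F x u))
      simpa using this
    refine e.congr_of_eventuallyEq ?_
    filter_upwards [isOpen_Ioi.mem_nhds (show (0 : ℝ) ∈ Ioi (-1) by simp)] with t ht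
    have := hF.grad_smul hx (τ := 1 + t) (by rw [mem_Ioi] at ht; linarith)
    rw [add_smul, one_smul] at this
    rw [this]; simp
  exact h1.unique h2

lemma nu_nonneg {x : E} (hx : x ∈ interior (K : Set E)) : 0 ≤ ν := by
  have := hF.hess_nonneg x hx x
  rwa [hF.hess_self hx, hF.grad_self hx, neg_neg] at this

/-- The tangent inequality at x is applied at τp. Since F(τp) = F(p) - ν ln τ stays bounded above
for τ ≥ 1, the linear growth τ⟨∇F(x), p⟩ cannot be positive. -/
lemma grad_nonpos_of_mem_interior {x p : E} (hx : x ∈ interior (K : Set E))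
    (hp : p ∈ interior (K : Set E)) : grad F x p ≤ 0 := by
  by_contra! hc
  have hν := hF.nu_nonneg hx
  have key : ∀ τ : ℝ, 1 ≤ τ → τ * grad F x p ≤ F p - F x - ν := fun τ hτ => by
    have h1 := hF.grad_le hx ((isCone_properCone K).smul_mem_interior hp (zero_lt_one.trans_le hτ))
    rw [hF.log_homogeneous p hp τ (zero_lt_one.trans_le hτ), map_sub, hF.grad_self hx, map_smul,
      smul_eq_mul] at h1
    have := mul_nonneg hν (Real.log_nonneg hτ)
    linarith
  have := key (1 + |F p - F x - ν| / grad F x p) (by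
    have : 0 ≤ |F p - F x - ν| / grad F x p := by positivity
    linarith)
  rw [add_mul, div_mul_cancel₀ _ hc.ne'] at this
  linarith [le_abs_self (F p - F x - ν)]

lemma grad_nonpos {x p : E} (hx : x ∈ interior (K : Set E)) (hp : p ∈ K) : grad F x p ≤ 0 := by
  have h : ∀ t : ℝ, t ∈ Ioi 0 → grad F x (t • x + p) ≤ 0 := fun t ht =>
    hF.grad_nonpos_of_mem_interior hx ((isCone_properCone K).add_mem_interior
      ((isCone_properCone K).smul_mem_interior hx ht) hp)
  have hc : Continuous fun t : ℝ => grad F x (t • x + p) := by fun_prop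
  have := (hc.tendsto 0).mono_left (nhdsWithin_le_nhds (s := Ioi 0))
  simpa using le_of_tendsto this (eventually_nhdsWithin_of_forall h)

/-- Self-concordance along a segment in the interior. -/
lemma abs_opNorm_sub_le {x h : E} {T : ℝ} (hT : 0 ≤ T)
    (hmem : ∀ t ∈ Icc 0 T, x + t • h ∈ interior (K : Set E)) :
    |opNorm (hess F x) h - opNorm (hess F (x + T • h)) h| ≤
      T * (opNorm (hess F x) h * opNorm (hess F (x + T • h)) h) := by
  have := abs_sqrt_sub_sqrt_le (g := fun t => hess F (x + t • h) h h) hT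
    (fun t ht => hasDerivAt_line_hess (hF.contDiffAt (hmem t ht)) h h)
    (fun t ht => hF.hess_nonneg _ (hmem t ht) h)
    (fun t ht => hF.self_concordant _ (hmem t ht) h)
  simpa [opNorm] using this

/-- The open Dikin ellipsoid is contained in the interior of the cone. -/
lemma add_mem_interior_of_opNorm_lt_one {x h : E} (hx : x ∈ interior (K : Set E))
    (hh : opNorm (hess F x) h < 1) : x + h ∈ interior (K : Set E) := by
  by_contra hcon
  have hline : Continuous fun t : ℝ => x + t • h := by fun_prop
  let S : Set ℝ := Icc 0 1 ∩ (fun t : ℝ => x + t • h) ⁻¹' (interior (K : Set E))ᶜ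
  have hS : IsCompact S :=
    isCompact_Icc.inter_right (isOpen_interior.isClosed_compl.preimage hline)
  -- T is the first exit time. Before T self-concordance bounds the Hessian along h by (a/(1-a))²,
  -- so two integrations keep F bounded, contrary to its blow-up at the frontier.
  obtain ⟨T, hTS, hTmin⟩ := hS.exists_isLeast ⟨1, by simp, by simpa using hcon⟩
  have hT0 : 0 < T := by
    rcases hTS.1.1.eq_or_lt with h0 | h0
    · exact absurd hx (by simpa [← h0] using hTS.2)
    · exact h0
  have hlt : ∀ t ∈ Ico 0 T, x + t • h ∈ interior (K : Set E) := fun t ht => by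
    by_contra hc
    exact absurd (hTmin ⟨⟨ht.1, ht.2.le.trans hTS.1.2⟩, hc⟩) (not_le.2 ht.2)
  set a := opNorm (hess F x) h with ha
  have ha0 : 0 ≤ a := opNorm_nonneg _ _
  set C := a / (1 - a) with hC
  have hC0 : 0 ≤ C := div_nonneg ha0 (by linarith)
  have hhess : ∀ t ∈ Ico 0 T, hess F (x + t • h) h h ≤ C ^ 2 := fun t ht => by
    have h1 := hF.abs_opNorm_sub_le ht.1 (h := h) (x := x)
      (fun r hr => hlt r ⟨hr.1, hr.2.trans_lt ht.2⟩)
    rw [← (hF.isPSD_hess (hlt t ht)).sq_opNorm]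
    refine pow_le_pow_left₀ (opNorm_nonneg _ _) ?_ 2
    rw [hC, le_div_iff₀ (by linarith)]
    have h2 : t * (a * opNorm (hess F (x + t • h)) h) ≤ 1 * (a * opNorm (hess F (x + t • h)) h) :=
      mul_le_mul_of_nonneg_right (ht.2.le.trans hTS.1.2) (mul_nonneg ha0 (opNorm_nonneg _ _))
    have h3 := (abs_le.1 h1).1
    linarith
  have hgrad : ∀ t ∈ Ico 0 T, grad F (x + t • h) h ≤ grad F x h + t * C ^ 2 := fun t ht => by
    have hsub : ∀ r ∈ Icc 0 t, r ∈ Ico 0 T := fun r hr => ⟨hr.1, hr.2.trans_lt ht.2⟩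
    have := monotoneOn_Icc_of_hasDerivAt (T := t)
      (g := fun r => r * C ^ 2 - grad F (x + r • h) h)
      (fun r hr => ((hasDerivAt_id r).mul_const _).sub
        (hasDerivAt_line_grad (hF.contDiffAt (hlt r (hsub r hr))) h))
      (fun r hr => by linarith [hhess r (hsub r hr)])
      (left_mem_Icc.2 ht.1) (right_mem_Icc.2 ht.1) ht.1
    simp only [zero_smul, add_zero, zero_mul, zero_sub] at this
    linarith
  have hval : ∀ t ∈ Ico 0 T, F (x + t • h) ≤ F x + (|grad F x h| + C ^ 2) := fun t ht => by
    have hsub : ∀ r ∈ Icc 0 t, r ∈ Ico 0 T := fun r hr => ⟨hr.1, hr.2.trans_lt ht.2⟩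
    have := monotoneOn_Icc_of_hasDerivAt (T := t)
      (g := fun r => r * (|grad F x h| + C ^ 2) - F (x + r • h))
      (fun r hr => ((hasDerivAt_id r).mul_const _).sub
        (hasDerivAt_line_apply (hF.contDiffAt (hlt r (hsub r hr)))))
      (fun r hr => by
        have h1 := hgrad r (hsub r hr)
        have h2 : r * C ^ 2 ≤ 1 * C ^ 2 := mul_le_mul_of_nonneg_right
          ((hsub r hr).2.le.trans hTS.1.2) (sq_nonneg C)
        linarith [le_abs_self (grad F x h)])
      (left_mem_Icc.2 ht.1) (right_mem_Icc.2 ht.1) ht.1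
    simp only [zero_smul, add_zero, zero_mul, zero_sub] at this
    have h2 : t * (|grad F x h| + C ^ 2) ≤ 1 * (|grad F x h| + C ^ 2) :=
      mul_le_mul_of_nonneg_right (ht.2.le.trans hTS.1.2) (by positivity)
    linarith
  have hnb : (𝓝[Ico 0 T] T).NeBot := by
    rw [← mem_closure_iff_nhdsWithin_neBot, closure_Ico hT0.ne]
    exact right_mem_Icc.2 hT0.le
  have htend : Tendsto (fun t : ℝ => x + t • h) (𝓝[Ico 0 T] T)
      (𝓝[interior (K : Set E)] (x + T • h)) :=
    tendsto_nhdsWithin_of_tendsto_nhds_of_eventually_within _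
      ((hline.tendsto T).mono_left nhdsWithin_le_nhds) (eventually_nhdsWithin_of_forall hlt)
  have hfr : x + T • h ∈ frontier (K : Set E) := by
    refine ⟨closure_mono interior_subset ?_, hTS.2⟩
    exact mem_closure_of_tendsto (htend.mono_right nhdsWithin_le_nhds)
      (eventually_nhdsWithin_of_forall hlt)
  have hev := ((hF.boundary _ hfr).comp htend).eventually
    (eventually_gt_atTop (F x + (|grad F x h| + C ^ 2)))
  obtain ⟨t, ht1, ht2⟩ := (hev.and (eventually_mem_nhdsWithin)).exists
  exact absurd (hval t ht2) (not_le.2 ht1)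

/-- A degenerate direction would put the whole line x + th into the Dikin ellipsoid, hence into K;
rescaling then gives ±h ∈ K, excluded by pointedness. -/
lemma hess_pos (hK : IsRegularCone K) {x : E} (hx : x ∈ interior (K : Set E)) (h : E)
    (hh : h ≠ 0) : 0 < hess F x h h := by
  refine lt_of_le_of_ne (hF.hess_nonneg x hx h) fun h0 => hh ?_
  have hn : opNorm (hess F x) h = 0 := by rw [opNorm, ← h0, Real.sqrt_zero]
  have hmem : ∀ t : ℝ, x + t • h ∈ K := fun t => interior_subset
    (hF.add_mem_interior_of_opNorm_lt_one hx (by rw [opNorm_smul, hn]; simp))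
  have hlim : ∀ σ : ℝ, σ • h ∈ K := fun σ => by
    have h1 : ∀ ε : ℝ, ε ∈ Ioi 0 → ε • x + σ • h ∈ (K : Set E) := fun ε hε => by
      have := K.smul_mem (hmem (ε⁻¹ * σ)) (le_of_lt hε)
      rwa [smul_add, smul_smul, ← mul_assoc, mul_inv_cancel₀ (ne_of_gt hε), one_mul] at this
    have hc : Continuous fun ε : ℝ => ε • x + σ • h := by fun_prop
    have := K.isClosed.mem_of_tendsto ((hc.tendsto 0).mono_left
      (nhdsWithin_le_nhds (s := Ioi 0))) (eventually_nhdsWithin_of_forall h1)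
    simpa using this
  exact hK.pointed h (by simpa using hlim 1) (by simpa using hlim (-1))

/-- The ray x + tp never leaves the interior, and self-concordance bounds the Hessian along it below
by (a/(1+ta))², the derivative of -a/(1+ta). Integrating, using ⟨∇F, p⟩ ≤ 0 at the far end, and
letting t → ∞ gives the bound. -/
lemma opNorm_le_of_mem {x p : E} (hx : x ∈ interior (K : Set E)) (hp : p ∈ K) :
    opNorm (hess F x) p ≤ -grad F x p := by
  set a := opNorm (hess F x) p with ha
  have ha0 : 0 ≤ a := opNorm_nonneg _ _
  have hmem : ∀ t : ℝ, 0 ≤ t → x + t • p ∈ interior (K : Set E) := fun t ht =>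
    (isCone_properCone K).add_smul_mem_interior hx hp ht
  have hlow : ∀ t : ℝ, 0 ≤ t → (a / (1 + t * a)) ^ 2 ≤ hess F (x + t • p) p p := fun t ht => by
    have h1 := (abs_le.1 (hF.abs_opNorm_sub_le ht (h := p) (x := x) (fun r hr => hmem r hr.1))).2
    rw [← (hF.isPSD_hess (hmem t ht)).sq_opNorm]
    refine pow_le_pow_left₀ (by positivity) ?_ 2
    rw [div_le_iff₀ (by positivity)]
    linarith
  have hmono := monotoneOn_Ici_of_hasDerivAt
    (g := fun t => grad F (x + t • p) p + a / (1 + t * a))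
    (g' := fun t => hess F (x + t • p) p p - (a / (1 + t * a)) ^ 2)
    (fun t ht => by
      have hp : (0 : ℝ) < 1 + t * a := by positivity
      have h2 := (((hasDerivAt_id t).mul_const a).const_add 1).inv (c := fun t => 1 + id t * a) hp.ne'
      have := (hasDerivAt_line_grad (hF.contDiffAt (hmem t ht)) p).add (h2.const_mul a)
      convert! this using 1
      simp only [id]
      field_simp
      ring)
    (fun t ht => by linarith [hlow t ht])
  have key : ∀ t : ℝ, 0 < t → a + grad F x p ≤ t⁻¹ := fun t ht => by
    have h1 := hmono (mem_Ici.2 le_rfl) (mem_Ici.2 ht.le) ht.le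
    have h2 := hF.grad_nonpos (hmem t ht.le) hp
    have h3 : a / (1 + t * a) ≤ t⁻¹ := by
      rw [div_le_iff₀ (by positivity), mul_add, inv_mul_cancel_left₀ ht.ne']
      have := inv_pos.2 ht
      linarith
    simp only [zero_smul, add_zero, zero_mul, div_one] at h1
    linarith
  have := ge_of_tendsto tendsto_inv_atTop_zero ((eventually_gt_atTop (0 : ℝ)).mono key)
  linarith

variable [FiniteDimensional ℝ E]

lemma exists_pos_le_hess (hK : IsRegularCone K) {x : E} (hx : x ∈ interior (K : Set E)) :
    ∃ ε > 0, ∀ h, ε * ‖h‖ ≤ opNorm (hess F x) h := by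
  have hcont : Continuous fun h => opNorm (hess F x) h := by unfold opNorm; fun_prop
  rcases (Metric.sphere (0 : E) 1).eq_empty_or_nonempty with he | hne
  · refine ⟨1, one_pos, fun h => ?_⟩
    have : h = 0 := by
      by_contra hh
      have : ‖h‖⁻¹ • h ∈ Metric.sphere (0 : E) 1 := by
        simp [norm_smul, inv_mul_cancel₀ (norm_ne_zero_iff.2 hh)]
      rw [he] at this
      exact this
    simp [this, opNorm]
  · obtain ⟨h0, hh0, hmin⟩ := (isCompact_sphere (0 : E) 1).exists_isMinOn hne hcont.continuousOn
    refine ⟨opNorm (hess F x) h0, Real.sqrt_pos.2 (hF.hess_pos hK hx h0 ?_), fun h => ?_⟩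
    · rintro rfl
      simp at hh0
    · by_cases hh : h = 0
      · simp [hh, opNorm]
      · have hn := norm_pos_iff.2 hh
        have : ‖h‖⁻¹ • h ∈ Metric.sphere (0 : E) 1 := by
          simp [norm_smul, inv_mul_cancel₀ hn.ne']
        have h1 := hmin this
        simp only [mem_ofPred_eq, opNorm_smul, abs_of_pos (inv_pos.2 hn)] at h1
        rwa [le_inv_mul_iff₀ hn, mul_comm] at h1

lemma neg_grad_mem_interior (hK : IsRegularCone K) {x : E} (hx : x ∈ interior (K : Set E)) :
    -grad F x ∈ interior (dualCone (K : Set E)) := by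
  obtain ⟨ε, hε, h⟩ := hF.exists_pos_le_hess hK hx
  exact mem_interior_dualCone_of_le hε fun p hp =>
    (h p).trans (hF.opNorm_le_of_mem hx hp)

/-- A linear function from the interior of the dual cone plus the barrier attains its minimum on
the part of a closed set in the interior of the cone. -/
lemma exists_isMinOn {s : StrongDual ℝ E} (hs : s ∈ interior (dualCone (K : Set E))) {S : Set E}
    (hS : IsClosed S) (hne : (S ∩ interior (K : Set E)).Nonempty) :
    ∃ x ∈ S ∩ interior (K : Set E), ∀ z ∈ S ∩ interior (K : Set E), s x + F x ≤ s z + F z := by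
  obtain ⟨x0, hx0S, hx0⟩ := hne
  obtain ⟨ε, hε, hsε⟩ := exists_pos_mul_norm_le hs
  set g := grad F x0
  -- The tangent to F is taken at τx₀, where the gradient is ∇F(x₀)/τ. This τ makes its slope at
  -- most ε/2, so it consumes only half of the growth of s and coercivity remains.
  set τ := 2 * ‖g‖ / ε + 1 with hτ
  have hτ0 : 0 < τ := by positivity
  have hlow : ∀ z ∈ interior (K : Set E), ε / 2 * ‖z‖ + (F (τ • x0) + ν) ≤ s z + F z :=
    fun z hz => by
      have hx := (isCone_properCone K).smul_mem_interior hx0 hτ0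
      have h1 := hF.grad_le hx hz
      rw [map_sub, hF.grad_self hx, hF.grad_smul hx0 hτ0, smul_apply, smul_eq_mul] at h1
      have h2 := (abs_le.1 (g.le_opNorm z)).1
      have h3 : τ⁻¹ * (‖g‖ * ‖z‖) ≤ ε / 2 * ‖z‖ := by
        rw [inv_mul_le_iff₀ hτ0, hτ]
        have : 2 * ‖g‖ / ε * (ε / 2 * ‖z‖) = ‖g‖ * ‖z‖ := by field_simp
        rw [add_mul, this]
        have : 0 ≤ ε / 2 * ‖z‖ := by positivity
        linarith
      have h4 : τ⁻¹ * (-(‖g‖ * ‖z‖)) ≤ τ⁻¹ * g z :=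
        mul_le_mul_of_nonneg_left h2 (inv_pos.2 hτ0).le
      have h5 := hsε z (interior_subset hz)
      linarith
  set a := s x0 + F x0
  let L : Set E := {z | z ∈ S ∩ interior (K : Set E) ∧ s z + F z ≤ a}
  have hLint : L ⊆ interior (K : Set E) := fun z hz => hz.1.2
  have hLcont : ContinuousOn (fun z => s z + F z) (interior (K : Set E)) :=
    s.continuous.continuousOn.add hF.smooth.continuousOn
  have hLclosed : IsClosed L := by
    refine isClosed_of_closure_subset fun z hz => ?_
    have hnb : (𝓝[L] z).NeBot := mem_closure_iff_nhdsWithin_neBot.1 hz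
    have hzS : z ∈ S := hS.closure_subset_iff.2 (fun w hw => hw.1.1) hz
    have hzint : z ∈ interior (K : Set E) := by
      by_contra hc
      have hfr : z ∈ frontier (K : Set E) :=
        ⟨closure_mono (hLint.trans interior_subset) hz, hc⟩
      have h1 := ((hF.boundary z hfr).mono_left (nhdsWithin_mono z hLint)).eventually
        (eventually_gt_atTop a)
      obtain ⟨w, hw1, hw2⟩ := (h1.and eventually_mem_nhdsWithin).exists
      have h2 := (mul_nonneg hε.le (norm_nonneg w)).trans (hsε w (interior_subset hw2.1.2))
      linarith [hw2.2]
    refine ⟨⟨hzS, hzint⟩, ?_⟩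
    exact le_of_tendsto ((hLcont z hzint).mono_left (nhdsWithin_mono z hLint))
      (eventually_nhdsWithin_of_forall fun w hw => hw.2)
  have hLbdd : L ⊆ Metric.closedBall 0 (2 / ε * (a - (F (τ • x0) + ν))) := fun z hz => by
    have h1 := hlow z hz.1.2
    have h2 := hz.2
    rw [mem_closedBall_zero_iff]
    have h3 : ‖z‖ = 2 / ε * (ε / 2 * ‖z‖) := by field_simp
    rw [h3]
    exact mul_le_mul_of_nonneg_left (by linarith) (by positivity)
  have hLcomp : IsCompact L := (isCompact_closedBall _ _).of_isClosed_subset hLclosed hLbdd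
  obtain ⟨x, hxL, hmin⟩ := hLcomp.exists_isMinOn ⟨x0, ⟨hx0S, hx0⟩, le_rfl⟩ (hLcont.mono hLint)
  refine ⟨x, hxL.1, fun z hz => ?_⟩
  by_cases hza : s z + F z ≤ a
  · exact hmin ⟨hz, hza⟩
  · exact hxL.2.trans (not_le.1 hza).le

end IsNormalBarrier

end Barrier

/-! ### The dual barrier -/

section DualBarrier

variable {E : Type*} [NormedAddCommGroup E] [NormedSpace ℝ E]
  {K : ProperCone ℝ E} {F : E → ℝ} {ν : ℝ}

lemma isInvertible_inclusionInDoubleDual [FiniteDimensional ℝ E] :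
    (NormedSpace.inclusionInDoubleDual ℝ E).IsInvertible := by
  have hinj : Function.Injective (NormedSpace.inclusionInDoubleDual ℝ E) :=
    (NormedSpace.inclusionInDoubleDualLi ℝ (E := E)).injective
  have hfr : ∀ (W : Type _) [NormedAddCommGroup W] [NormedSpace ℝ W] [FiniteDimensional ℝ W],
      Module.finrank ℝ W = Module.finrank ℝ (StrongDual ℝ W) := fun W _ _ _ => by
    rw [← Subspace.dual_finrank_eq (K := ℝ) (V := W)]
    exact LinearEquiv.finrank_eq (LinearMap.toContinuousLinearMap (𝕜 := ℝ) (E := W) (F' := ℝ))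
  exact ⟨(LinearEquiv.ofInjectiveOfFinrankEq
    (NormedSpace.inclusionInDoubleDual ℝ E : E →ₗ[ℝ] StrongDual ℝ (StrongDual ℝ E)) hinj
    ((hfr E).trans (hfr _))).toContinuousLinearEquiv, by ext; rfl⟩

lemma apply_fromBidual [FiniteDimensional ℝ E] (ψ : StrongDual ℝ (StrongDual ℝ E))
    (u : StrongDual ℝ E) : u (fromBidual ψ) = ψ u := by
  conv_rhs => rw [isInvertible_inclusionInDoubleDual.inverse_apply_eq.1 (rfl : _ = fromBidual ψ)]
  rfl

/-- The point of the interior of the cone at which the gradient of the barrier is `-s`. -/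
def primalPoint (K : ProperCone ℝ E) (F : E → ℝ) (s : StrongDual ℝ E) : E :=
  Classical.epsilon fun x => x ∈ interior (K : Set E) ∧ grad F x = -s

namespace IsNormalBarrier

variable (hF : IsNormalBarrier (K : Set E) F ν) (hK : IsRegularCone K)
include hF hK

lemma grad_injOn : InjOn (grad F) (interior (K : Set E)) := by
  intro x hx z hz hxz
  by_contra hne
  have hmem : ∀ t ∈ Icc (0 : ℝ) 1, x + t • (z - x) ∈ interior (K : Set E) := fun t ht =>
    (isCone_properCone K).convex.interior.add_smul_sub_mem hx hz ht
  have hder := fun t ht => hasDerivAt_line_grad (hF.contDiffAt (hmem t ht)) (z - x)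
  obtain ⟨c, hc, hc'⟩ := exists_hasDerivAt_eq_slope _ _ (zero_lt_one' ℝ)
    (fun t ht => (hder t ht).continuousAt.continuousWithinAt)
    (fun t ht => hder t (Ioo_subset_Icc_self ht))
  have := hF.hess_pos hK (hmem c (Ioo_subset_Icc_self hc)) (z - x) (sub_ne_zero.2 (Ne.symm hne))
  rw [hc'] at this
  simp [hxz] at this

lemma primalPoint_eq {s : StrongDual ℝ E} {x : E} (hx : x ∈ interior (K : Set E))
    (hg : grad F x = -s) : primalPoint K F s = x := by
  have := Classical.epsilon_spec
    (p := fun x => x ∈ interior (K : Set E) ∧ grad F x = -s) ⟨x, hx, hg⟩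
  exact hF.grad_injOn hK this.1 hx (this.2.trans hg.symm)

variable [FiniteDimensional ℝ E]
variable {s : StrongDual ℝ E} (hs : s ∈ interior (dualCone (K : Set E)))
include hs

lemma primalPoint_spec :
    primalPoint K F s ∈ interior (K : Set E) ∧ grad F (primalPoint K F s) = -s := by
  refine Classical.epsilon_spec (p := fun x => x ∈ interior (K : Set E) ∧ grad F x = -s) ?_
  obtain ⟨x, hx, hmin⟩ := hF.exists_isMinOn hs isClosed_univ (by simpa using hK.solid)
  refine ⟨x, hx.2, ?_⟩
  have hloc : IsLocalMin (fun z => s z + F z) x := by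
    filter_upwards [isOpen_interior.mem_nhds hx.2] with z hz
    exact hmin z ⟨mem_univ _, hz⟩
  have := hloc.hasFDerivAt_eq_zero (s.hasFDerivAt.add (hasFDerivAt_grad (hF.contDiffAt hx.2)))
  rw [eq_neg_iff_add_eq_zero, add_comm]
  exact this

lemma primalPoint_mem : primalPoint K F s ∈ interior (K : Set E) :=
  (hF.primalPoint_spec hK hs).1

lemma grad_primalPoint : grad F (primalPoint K F s) = -s := (hF.primalPoint_spec hK hs).2

lemma apply_primalPoint : s (primalPoint K F s) = ν := by
  have := hF.grad_self (hF.primalPoint_mem hK hs)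
  rw [hF.grad_primalPoint hK hs] at this
  simpa using this

lemma primalPoint_smul {τ : ℝ} (hτ : 0 < τ) :
    primalPoint K F (τ • s) = τ⁻¹ • primalPoint K F s := by
  have hx := hF.primalPoint_mem hK hs
  refine hF.primalPoint_eq hK ((isCone_properCone K).smul_mem_interior hx (inv_pos.2 hτ)) ?_
  rw [hF.grad_smul hx (inv_pos.2 hτ), inv_inv, hF.grad_primalPoint hK hs, smul_neg]

/-- The inverse function theorem applies to -∇F, which is C² with invertible derivative; injectivity
of ∇F identifies the local inverse with `primalPoint`. -/
lemma contDiffAt_primalPoint : ContDiffAt ℝ 2 (primalPoint K F) s := by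
  have := FiniteDimensional.complete ℝ E
  set x := primalPoint K F s
  have hx := hF.primalPoint_mem hK hs
  obtain ⟨e, he⟩ := isInvertible_of_pos (hF.hess_pos hK hx)
  have hT : ContDiffAt ℝ 2 (fun z => -grad F z) x := (contDiffAt_grad (hF.contDiffAt hx)).neg
  have hT' : HasFDerivAt (fun z => -grad F z)
      ((e.trans (ContinuousLinearEquiv.neg ℝ) : E ≃L[ℝ] StrongDual ℝ E) :
        E →L[ℝ] StrongDual ℝ E) x := by
    convert! (hasFDerivAt_hess (hF.contDiffAt hx)).neg using 1
    rw [← he]; rfl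
  have hTs : -grad F x = s := by rw [hF.grad_primalPoint hK hs, neg_neg]
  have h1 := hT.to_localInverse hT' (by norm_num)
  have hS := hT.hasStrictFDerivAt' hT' (by norm_num)
  have h2 := hS.eventually_right_inverse
  have h3 := hS.localInverse_continuousAt
  have h4 := hS.localInverse_apply_image
  rw [hTs] at h1 h2 h3 h4
  refine h1.congr_of_eventuallyEq ?_
  have h5 := h3.eventually (by rw [h4]; exact isOpen_interior.mem_nhds hx)
  filter_upwards [h2, h5] with u hu1 hu2
  exact hF.primalPoint_eq hK hu2 (neg_eq_iff_eq_neg.1 hu1)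

lemma hess_fderiv_primalPoint (u : StrongDual ℝ E) :
    hess F (primalPoint K F s) (fderiv ℝ (primalPoint K F) s u) = -u := by
  have hx := hF.primalPoint_mem hK hs
  have h1 := (hasFDerivAt_hess (hF.contDiffAt hx)).comp s
    ((hF.contDiffAt_primalPoint hK hs).differentiableAt (by norm_num)).hasFDerivAt
  have h2 : HasFDerivAt (grad F ∘ primalPoint K F) (-ContinuousLinearMap.id ℝ _) s := by
    refine (hasFDerivAt_id s).neg.congr_of_eventuallyEq ?_
    filter_upwards [isOpen_interior.mem_nhds hs] with u hu
    exact hF.grad_primalPoint hK hu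
  exact congrArg (fun L => L u) (h1.unique h2)

lemma dualBarrier_eq :
    dualBarrier (K : Set E) F s = -(s (primalPoint K F s)) - F (primalPoint K F s) := by
  have hx := hF.primalPoint_mem hK hs
  have hle : ∀ z : interior (K : Set E), -(s z) - F z ≤
      -(s (primalPoint K F s)) - F (primalPoint K F s) := fun z => by
    have := hF.grad_le hx z.2
    rw [hF.grad_primalPoint hK hs] at this
    simp only [neg_apply, map_sub] at this
    linarith
  have : Nonempty (interior (K : Set E)) := ⟨⟨_, hx⟩⟩
  exact le_antisymm (ciSup_le hle) (le_ciSup (f := fun z : interior (K : Set E) => -(s z) - F z)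
    ⟨_, by rintro _ ⟨z, rfl⟩; exact hle z⟩ ⟨_, hx⟩)

/-- Envelope argument: the terms containing the derivative of the maximizer cancel because ∇F = -s
there. -/
lemma hasFDerivAt_dualBarrier : HasFDerivAt (dualBarrier (K : Set E) F)
    (-NormedSpace.inclusionInDoubleDual ℝ E (primalPoint K F s)) s := by
  have hx := hF.primalPoint_mem hK hs
  have hX := ((hF.contDiffAt_primalPoint hK hs).differentiableAt (by norm_num)).hasFDerivAt
  have h1 := ((hasFDerivAt_id s).clm_apply hX).neg.sub
    ((hasFDerivAt_grad (hF.contDiffAt hx)).comp s hX)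
  refine (h1.congr_of_eventuallyEq ?_).congr_fderiv ?_
  · filter_upwards [isOpen_interior.mem_nhds hs] with u hu
    exact hF.dualBarrier_eq hK hu
  · ext u
    simp [hF.grad_primalPoint hK hs]

lemma grad_dualBarrier (u : StrongDual ℝ E) :
    grad (dualBarrier (K : Set E) F) s u = -u (primalPoint K F s) := by
  rw [grad, (hF.hasFDerivAt_dualBarrier hK hs).fderiv]
  simp

lemma contDiffAt_dualBarrier : ContDiffAt ℝ 3 (dualBarrier (K : Set E) F) s := by
  have : ContDiffAt ℝ ((2 : ℕ) + 1) (dualBarrier (K : Set E) F) s := by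
    rw [contDiffAt_succ_iff_hasFDerivAt]
    refine ⟨_, ⟨_, isOpen_interior.mem_nhds hs, fun u hu => hF.hasFDerivAt_dualBarrier hK hu⟩, ?_⟩
    exact ((ContinuousLinearMap.contDiff (F := StrongDual ℝ (StrongDual ℝ E))
      (NormedSpace.inclusionInDoubleDual ℝ E)).contDiffAt.comp s
      (hF.contDiffAt_primalPoint hK hs)).neg
  exact_mod_cast this

lemma hess_dualBarrier (u : StrongDual ℝ E) :
    hess (dualBarrier (K : Set E) F) s u =
      NormedSpace.inclusionInDoubleDual ℝ E ((hess F (primalPoint K F s)).inverse u) := by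
  have hx := hF.primalPoint_mem hK hs
  have hX := ((hF.contDiffAt_primalPoint hK hs).differentiableAt (by norm_num)).hasFDerivAt
  have h1 : HasFDerivAt (grad (dualBarrier (K : Set E) F))
      (-((NormedSpace.inclusionInDoubleDual ℝ E).comp (fderiv ℝ (primalPoint K F) s))) s := by
    refine ((NormedSpace.inclusionInDoubleDual ℝ E).hasFDerivAt.comp s
      hX).neg.congr_of_eventuallyEq ?_
    filter_upwards [isOpen_interior.mem_nhds hs] with u hu
    exact (hF.hasFDerivAt_dualBarrier hK hu).fderiv
  have h2 : (hess F (primalPoint K F s)).inverse u = -fderiv ℝ (primalPoint K F) s u := by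
    rw [(isInvertible_of_pos (hF.hess_pos hK hx)).inverse_apply_eq, map_neg,
      hF.hess_fderiv_primalPoint hK hs, neg_neg]
  rw [hess, HasFDerivAt.fderiv (f := fderiv ℝ (dualBarrier (K : Set E) F)) h1, h2]
  simp

lemma hess_dualBarrier_apply (u w : StrongDual ℝ E) :
    hess (dualBarrier (K : Set E) F) s u w = w ((hess F (primalPoint K F s)).inverse u) := by
  rw [hF.hess_dualBarrier hK hs]; rfl

/-- The norm of `u` in the dual local metric is the primal local norm of its Riesz representer. -/
lemma opNorm_inverse (u : StrongDual ℝ E) :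
    opNorm (hess F (primalPoint K F s)) ((hess F (primalPoint K F s)).inverse u) =
      opNorm (hess (dualBarrier (K : Set E) F) s) u := by
  rw [opNorm, opNorm, apply_inverse_of_pos (hF.hess_pos hK (hF.primalPoint_mem hK hs)),
    hF.hess_dualBarrier_apply hK hs]

lemma hess_dualBarrier_pos (u : StrongDual ℝ E) (hu : u ≠ 0) :
    0 < hess (dualBarrier (K : Set E) F) s u u := by
  have hp := hF.hess_pos hK (hF.primalPoint_mem hK hs)
  rw [hF.hess_dualBarrier_apply hK hs]
  have := hp ((hess F (primalPoint K F s)).inverse u) (fun h0 => hu (by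
    rw [← apply_inverse_of_pos hp u, h0, map_zero]))
  rwa [apply_inverse_of_pos hp] at this

lemma isPSD_hess_dualBarrier : IsPSD (hess (dualBarrier (K : Set E) F) s) :=
  ⟨hess_symm (hF.contDiffAt_dualBarrier hK hs), fun u => by
    rcases eq_or_ne u 0 with rfl | hu
    · simp
    · exact (hF.hess_dualBarrier_pos hK hs u hu).le⟩

lemma hess_dualBarrier_self (u : StrongDual ℝ E) :
    hess (dualBarrier (K : Set E) F) s s u = u (primalPoint K F s) := by
  have hx := hF.primalPoint_mem hK hs
  have hp := hF.hess_pos hK hx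
  have : hess F (primalPoint K F s) (primalPoint K F s) = s := by
    ext u
    rw [hF.hess_self hx, hF.grad_primalPoint hK hs]; simp
  rw [hF.hess_dualBarrier_apply hK hs]
  conv_lhs => rw [← this]
  rw [hF.primalPoint_eq hK hx (by rw [this]; exact hF.grad_primalPoint hK hs),
    inverse_apply_of_pos hp]

lemma hess_dualBarrier_smul {τ : ℝ} (hτ : 0 < τ) (u w : StrongDual ℝ E) :
    hess (dualBarrier (K : Set E) F) (τ • s) u w =
      (τ ^ 2)⁻¹ * hess (dualBarrier (K : Set E) F) s u w := by
  have hC := isCone_dualCone (K : Set E)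
  have hτs := hC.smul_mem_interior hs hτ
  have h1 : HasFDerivAt (fun z => grad (dualBarrier (K : Set E) F) (τ • z))
      (τ • hess (dualBarrier (K : Set E) F) (τ • s)) s := by
    have := (hasFDerivAt_hess (hF.contDiffAt_dualBarrier hK hτs)).comp
      s ((hasFDerivAt_id s).const_smul τ)
    convert! this using 1
    ext; simp
  have h2 : HasFDerivAt (fun z => grad (dualBarrier (K : Set E) F) (τ • z))
      (τ⁻¹ • hess (dualBarrier (K : Set E) F) s) s := by
    refine ((hasFDerivAt_hess (hF.contDiffAt_dualBarrier hK hs)).const_smul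
      τ⁻¹).congr_of_eventuallyEq ?_
    filter_upwards [isOpen_interior.mem_nhds hs] with z hz
    ext u
    rw [hF.grad_dualBarrier hK (hC.smul_mem_interior hz hτ), hF.primalPoint_smul hK hz hτ]
    simp [hF.grad_dualBarrier hK hz]
  have := congrArg (fun L => L u w) (h1.unique h2)
  simp only [smul_apply, smul_eq_mul] at this
  field_simp at this ⊢
  linarith

/-- The Dikin ellipsoid of the dual barrier, in functional form. -/
lemma abs_apply_le (u : StrongDual ℝ E) {p : E} (hp : p ∈ K) :
    |u p| ≤ opNorm (hess (dualBarrier (K : Set E) F) s) u * s p := by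
  have hx := hF.primalPoint_mem hK hs
  have h1 := (hF.isPSD_hess hx).abs_apply_le ((hess F (primalPoint K F s)).inverse u) p
  rw [apply_inverse_of_pos (hF.hess_pos hK hx), hF.opNorm_inverse hK hs] at h1
  have h2 := hF.opNorm_le_of_mem hx hp
  rw [hF.grad_primalPoint hK hs, neg_apply, neg_neg] at h2
  exact h1.trans (mul_le_mul_of_nonneg_left h2 (opNorm_nonneg _ _))

lemma smul_add_mem_dualCone {u : StrongDual ℝ E} {r : ℝ}
    (hr : opNorm (hess (dualBarrier (K : Set E) F) s) u ≤ r) :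
    r • s + u ∈ dualCone (K : Set E) := fun p hp => by
  have h1 := (abs_le.1 (hF.abs_apply_le hK hs u hp)).1
  have h2 := mul_le_mul_of_nonneg_right hr (interior_subset hs p hp)
  simp only [add_apply, smul_apply, smul_eq_mul]
  linarith

lemma smul_sub_mem_dualCone {u : StrongDual ℝ E} {r : ℝ}
    (hr : opNorm (hess (dualBarrier (K : Set E) F) s) u ≤ r) :
    r • s - u ∈ dualCone (K : Set E) := by
  rw [sub_eq_add_neg]
  exact hF.smul_add_mem_dualCone hK hs (by rwa [opNorm_neg])

/-- The dual counterpart of `opNorm_le_of_mem`, obtained from the primal Dikin ellipsoid: p is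
nonnegative at the points moved from -∇F_*(s) against the Riesz representer of p by a local length t
< 1, and then t → 1. -/
lemma opNorm_dualBarrier_le_of_mem {p : StrongDual ℝ E} (hp : p ∈ dualCone (K : Set E)) :
    opNorm (hess (dualBarrier (K : Set E) F) s) p ≤ p (primalPoint K F s) := by
  have hx := hF.primalPoint_mem hK hs
  set a := opNorm (hess (dualBarrier (K : Set E) F) s) p with ha
  set z := (hess F (primalPoint K F s)).inverse p with hz
  have hza : opNorm (hess F (primalPoint K F s)) z = a := hF.opNorm_inverse hK hs p
  have ha2 : a ^ 2 = p z := by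
    rw [ha, (hF.isPSD_hess_dualBarrier hK hs).sq_opNorm, hF.hess_dualBarrier_apply hK hs]
  have hpos : 0 ≤ p (primalPoint K F s) := hp _ (interior_subset hx)
  rcases (opNorm_nonneg (hess (dualBarrier (K : Set E) F) s) p).eq_or_lt with h0 | h0
  · exact (ha.trans h0.symm).le.trans hpos
  · change 0 < a at h0
    have key : ∀ t : ℝ, t ∈ Ico 0 1 → t * a ≤ p (primalPoint K F s) := fun t ht => by
      have h1 := hF.add_mem_interior_of_opNorm_lt_one hx (h := -((t / a) • z)) (by
        rw [opNorm_neg, opNorm_smul, hza, abs_of_nonneg (div_nonneg ht.1 h0.le),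
          div_mul_cancel₀ _ h0.ne']
        exact ht.2)
      have h2 := hp _ (interior_subset h1)
      rw [map_add, map_neg, map_smul, smul_eq_mul, ← ha2] at h2
      have : t / a * a ^ 2 = t * a := by field_simp
      linarith
    have hc : Continuous fun t : ℝ => t * a := by fun_prop
    have hnb : (𝓝[Ico (0 : ℝ) 1] 1).NeBot := by
      rw [← mem_closure_iff_nhdsWithin_neBot, closure_Ico zero_ne_one]
      exact right_mem_Icc.2 zero_le_one
    simpa using le_of_tendsto ((hc.tendsto 1).mono_left (nhdsWithin_le_nhds (s := Ico 0 1)))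
      (eventually_nhdsWithin_of_forall key)

/-! ### Consequences of negative curvature of the dual barrier -/

variable (hcurv : HasNegativeCurvature (dualCone (K : Set E)) (dualBarrier (K : Set E) F))
include hcurv

lemma hess_dualBarrier_add_le {p : StrongDual ℝ E} (hp : p ∈ dualCone (K : Set E))
    (u : StrongDual ℝ E) : hess (dualBarrier (K : Set E) F) (s + p) u u ≤
      hess (dualBarrier (K : Set E) F) s u u := by
  have hmem : ∀ t : ℝ, 0 ≤ t → s + t • p ∈ interior (dualCone (K : Set E)) := fun t ht =>
    (isCone_dualCone (K : Set E)).add_smul_mem_interior hs hp ht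
  have := monotoneOn_Ici_of_hasDerivAt
    (fun t ht => (hasDerivAt_line_hess (hF.contDiffAt_dualBarrier hK (hmem t ht)) u u).neg)
    (fun t ht => neg_nonneg.2 (hcurv _ (hmem t ht) p hp u))
    (mem_Ici.2 le_rfl) (mem_Ici.2 zero_le_one) zero_le_one
  simpa using this

lemma hess_dualBarrier_le_of_sub_mem {s' : StrongDual ℝ E} {c : ℝ} (hc : 0 < c)
    (h : s' - c • s ∈ dualCone (K : Set E)) (u : StrongDual ℝ E) :
    hess (dualBarrier (K : Set E) F) s' u u ≤
      (c ^ 2)⁻¹ * hess (dualBarrier (K : Set E) F) s u u := by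
  rw [← hF.hess_dualBarrier_smul hK hs hc]
  simpa using hF.hess_dualBarrier_add_le hK
    ((isCone_dualCone (K : Set E)).smul_mem_interior hs hc) hcurv h u

/-- By negative curvature ⟨∇²F_*(s+tp)p, h⟩ is nonincreasing in t. A negative value at t = 0 would
make ⟨h, -∇F_*(s+tp)⟩ grow linearly, but these points stay bounded because s pairs with them to at
most ν. -/
lemma hess_dualBarrier_nonneg {p h : StrongDual ℝ E} (hp : p ∈ dualCone (K : Set E))
    (hh : h ∈ dualCone (K : Set E)) : 0 ≤ hess (dualBarrier (K : Set E) F) s p h := by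
  by_contra! hneg
  set Φ := dualBarrier (K : Set E) F
  have hmem : ∀ t : ℝ, 0 ≤ t → s + t • p ∈ interior (dualCone (K : Set E)) := fun t ht =>
    (isCone_dualCone (K : Set E)).add_smul_mem_interior hs hp ht
  have hmono := monotoneOn_Ici_of_hasDerivAt
    (fun t ht => (hasDerivAt_line_hess (hF.contDiffAt_dualBarrier hK (hmem t ht)) p h).neg)
    (fun t ht => neg_nonneg.2 (by
      have hcd := hF.contDiffAt_dualBarrier hK (hmem t ht)
      rw [third_swap_right hcd, third_swap_left hcd]
      exact hcurv _ (hmem t ht) h hh p))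
  have hmono2 := monotoneOn_Ici_of_hasDerivAt
    (g := fun t => -grad Φ (s + t • p) h - t * (-hess Φ s p h))
    (fun t ht => (hasDerivAt_line_grad (hF.contDiffAt_dualBarrier hK (hmem t ht)) h).neg.sub
      ((hasDerivAt_id t).mul_const _))
    (fun t ht => by
      have := hmono (mem_Ici.2 le_rfl) (mem_Ici.2 ht) ht
      simp only [zero_smul, add_zero, Pi.neg_apply] at this
      linarith)
  obtain ⟨ε, hε, hsε⟩ := exists_pos_mul_norm_le hs
  have hbd : ∀ t : ℝ, 0 ≤ t → h (primalPoint K F (s + t • p)) ≤ ‖h‖ * (ν / ε) := fun t ht => by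
    have hx := interior_subset (hF.primalPoint_mem hK (hmem t ht))
    have h1 := hF.apply_primalPoint hK (hmem t ht)
    have h2 := mul_nonneg ht (hp _ hx)
    simp only [add_apply, smul_apply, smul_eq_mul] at h1
    refine (le_abs_self _).trans ((h.le_opNorm _).trans
      (mul_le_mul_of_nonneg_left ?_ (norm_nonneg _)))
    rw [le_div_iff₀ hε, mul_comm]
    exact (hsε _ hx).trans (by linarith)
  have hh0 := hh _ (interior_subset (hF.primalPoint_mem hK hs))
  have key : ∀ t : ℝ, 0 ≤ t → t * (-hess Φ s p h) ≤ ‖h‖ * (ν / ε) := fun t ht => by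
    have h1 := hmono2 (mem_Ici.2 le_rfl) (mem_Ici.2 ht) ht
    simp only [zero_smul, add_zero, zero_mul, sub_zero, hF.grad_dualBarrier hK hs,
      hF.grad_dualBarrier hK (hmem t ht), neg_neg, Φ] at h1
    have := hbd t ht
    linarith
  have hc : 0 < -hess Φ s p h := by linarith
  have := key ((|‖h‖ * (ν / ε)| + 1) / (-hess Φ s p h)) (by positivity)
  rw [div_mul_cancel₀ _ hc.ne'] at this
  linarith [le_abs_self (‖h‖ * (ν / ε))]

lemma apply_primalPoint_add_le {p h : StrongDual ℝ E} (hp : p ∈ dualCone (K : Set E))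
    (hh : h ∈ dualCone (K : Set E)) :
    h (primalPoint K F (s + p)) ≤ h (primalPoint K F s) := by
  have hmem : ∀ t : ℝ, 0 ≤ t → s + t • p ∈ interior (dualCone (K : Set E)) := fun t ht =>
    (isCone_dualCone (K : Set E)).add_smul_mem_interior hs hp ht
  have := monotoneOn_Ici_of_hasDerivAt
    (fun t ht => hasDerivAt_line_grad (hF.contDiffAt_dualBarrier hK (hmem t ht)) h)
    (fun t ht => hF.hess_dualBarrier_nonneg hK (hmem t ht) hcurv hp hh)
    (mem_Ici.2 le_rfl) (mem_Ici.2 zero_le_one) zero_le_one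
  beta_reduce at this
  rw [hF.grad_dualBarrier hK (hmem 0 le_rfl), hF.grad_dualBarrier hK (hmem 1 zero_le_one)] at this
  simpa using this

lemma apply_primalPoint_le_of_sub_mem {s' h : StrongDual ℝ E} {c : ℝ} (hc : 0 < c)
    (hsub : s' - c • s ∈ dualCone (K : Set E)) (hh : h ∈ dualCone (K : Set E)) :
    h (primalPoint K F s') ≤ c⁻¹ * h (primalPoint K F s) := by
  have := hF.apply_primalPoint_add_le hK
    ((isCone_dualCone (K : Set E)).smul_mem_interior hs hc) hcurv hsub hh
  rw [hF.primalPoint_smul hK hs hc] at this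
  simpa using this

/-- The rate of decrease of ⟨h, -∇F_*⟩ along p is itself nonincreasing, so the initial rate
dominates for any length of p. This is why long predictor steps remain under control. -/
lemma sub_apply_primalPoint_add_le {p h : StrongDual ℝ E} (hp : p ∈ dualCone (K : Set E))
    (hh : h ∈ dualCone (K : Set E)) :
    h (primalPoint K F s) - h (primalPoint K F (s + p)) ≤
      hess (dualBarrier (K : Set E) F) s p h := by
  set Φ := dualBarrier (K : Set E) F
  have hmem : ∀ t : ℝ, 0 ≤ t → s + t • p ∈ interior (dualCone (K : Set E)) := fun t ht =>
    (isCone_dualCone (K : Set E)).add_smul_mem_interior hs hp ht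
  have hmono := monotoneOn_Ici_of_hasDerivAt
    (fun t ht => (hasDerivAt_line_hess (hF.contDiffAt_dualBarrier hK (hmem t ht)) p h).neg)
    (fun t ht => neg_nonneg.2 (by
      have hcd := hF.contDiffAt_dualBarrier hK (hmem t ht)
      rw [third_swap_right hcd, third_swap_left hcd]
      exact hcurv _ (hmem t ht) h hh p))
  have hmono2 := monotoneOn_Ici_of_hasDerivAt
    (g := fun t => -grad Φ (s + t • p) h - t * (-hess Φ s p h))
    (fun t ht => (hasDerivAt_line_grad (hF.contDiffAt_dualBarrier hK (hmem t ht)) h).neg.sub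
      ((hasDerivAt_id t).mul_const _))
    (fun t ht => by
      have := hmono (mem_Ici.2 le_rfl) (mem_Ici.2 ht) ht
      simp only [zero_smul, add_zero, Pi.neg_apply] at this
      linarith)
    (mem_Ici.2 le_rfl) (mem_Ici.2 zero_le_one) zero_le_one
  simp only [Φ] at hmono2
  rw [hF.grad_dualBarrier hK (hmem 0 le_rfl), hF.grad_dualBarrier hK (hmem 1 zero_le_one)] at hmono2
  simp only [zero_smul, add_zero, one_smul, neg_neg, zero_mul, sub_zero, one_mul] at hmono2
  linarith

/-- Strong monotonicity of the gradient of the dual barrier in the local metric. -/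
lemma sq_div_le_sub_apply {d : StrongDual ℝ E} (hd : s + d ∈ interior (dualCone (K : Set E))) :
    opNorm (hess (dualBarrier (K : Set E) F) s) d ^ 2 /
        (1 + opNorm (hess (dualBarrier (K : Set E) F) s) d) ≤
      d (primalPoint K F s) - d (primalPoint K F (s + d)) := by
  set Φ := dualBarrier (K : Set E) F with hΦ
  set r := opNorm (hess Φ s) d with hr
  have hr0 : 0 ≤ r := opNorm_nonneg _ _
  have hC := isCone_dualCone (K : Set E)
  have hmem : ∀ t ∈ Icc (0 : ℝ) 1, s + t • d ∈ interior (dualCone (K : Set E)) := fun t ht => by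
    have := hC.convex.interior.add_smul_sub_mem hs hd ht
    simpa using this
  have hlow : ∀ t ∈ Icc (0 : ℝ) 1, (r / (1 + t * r)) ^ 2 ≤ hess Φ (s + t • d) d d := fun t ht => by
    have ht0 : 0 < 1 + t * r := by have := mul_nonneg ht.1 hr0; positivity
    -- Since rs - d ∈ K^*, the point s + td is at most (1 + tr)s in the cone order. Negative
    -- curvature and homogeneity turn this into the lower bound for the Hessian at s + td.
    have hsub : s - (1 + t * r)⁻¹ • (s + t • d) ∈ dualCone (K : Set E) := by
      have h1 := hC.smul_mem ((1 + t * r)⁻¹ * t) (mul_nonneg (inv_pos.2 ht0).le ht.1) _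
        (hF.smul_sub_mem_dualCone hK hs (u := d) (r := r) le_rfl)
      convert! h1 using 1
      have h2 : s = ((1 + t * r)⁻¹ * (1 + t * r)) • s := by
        rw [inv_mul_cancel₀ ht0.ne', one_smul]
      conv_lhs => enter [1]; rw [h2]
      module
    have h3 := hF.hess_dualBarrier_le_of_sub_mem hK (hmem t ht) hcurv (inv_pos.2 ht0) hsub d
    rw [← hΦ, ← (hF.isPSD_hess_dualBarrier hK hs).sq_opNorm, ← hr, inv_pow, inv_inv] at h3
    rw [div_pow, div_le_iff₀ (by positivity)]
    linarith
  have hmono := monotoneOn_Icc_of_hasDerivAt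
    (g := fun t => grad Φ (s + t • d) d + r / (1 + t * r))
    (g' := fun t => hess Φ (s + t • d) d d - (r / (1 + t * r)) ^ 2)
    (fun t ht => by
      have hp : (0 : ℝ) < 1 + t * r := by have := mul_nonneg ht.1 hr0; positivity
      have h2 := (((hasDerivAt_id t).mul_const r).const_add 1).inv (c := fun t => 1 + id t * r) hp.ne'
      have := (hasDerivAt_line_grad (hF.contDiffAt_dualBarrier hK (hmem t ht)) d).add
        (h2.const_mul r)
      convert! this using 1
      simp only [id]
      field_simp
      ring)
    (fun t ht => by linarith [hlow t ht])
    (left_mem_Icc.2 zero_le_one) (right_mem_Icc.2 zero_le_one) zero_le_one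
  simp only [zero_smul, add_zero, one_smul, zero_mul, one_mul, div_one, hΦ,
    hF.grad_dualBarrier hK hs, hF.grad_dualBarrier hK hd] at hmono
  have : r ^ 2 / (1 + r) = r - r / (1 + r) := by field_simp; ring
  rw [this]
  linarith

end IsNormalBarrier

end DualBarrier

/-! ### The conic problem: standing assumptions and local norms on the dual -/

namespace ConicProblem

variable {E H : Type*} [NormedAddCommGroup E] [NormedSpace ℝ E]
  [NormedAddCommGroup H] [NormedSpace ℝ H] {P : ConicProblem E H}

/-- The standing assumptions on the primal-dual problem. -/
structure IsStandard (P : ConicProblem E H) : Prop where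
  cone : IsRegularCone P.K
  barrier : IsNormalBarrier (P.K : Set E) P.F P.ν
  surj : Function.Surjective P.A
  feas : P.StrictlyFeasible
  curv : HasNegativeCurvature P.Kd P.Fd

/-- The maximizer defining the dual barrier at `s`, which is `-∇F_*(s)`. -/
def X (P : ConicProblem E H) (s : StrongDual ℝ E) : E := primalPoint P.K P.F s

/-- The Hessian of the dual barrier. -/
def M (P : ConicProblem E H) (s : StrongDual ℝ E) :
    StrongDual ℝ E →L[ℝ] StrongDual ℝ (StrongDual ℝ E) := hess P.Fd s

lemma isCone_Kd : IsCone P.Kd := isCone_dualCone _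

lemma Aadj_apply (h : H) (x : E) : P.Aadj h x = P.A x h := rfl

lemma slack_add (y h : H) : P.slack (y + h) = P.slack y - P.Aadj h := by
  simp only [slack, map_add]; abel

lemma Aadj_sub_eq (y z : H) : P.Aadj (y - z) = P.slack z - P.slack y := by
  simp only [slack, map_sub]; abel

lemma slack_add_smul (y h : H) (t : ℝ) :
    P.slack (y + t • h) = P.slack y + t • (-P.Aadj h) := by
  rw [slack_add, map_smul, smul_neg, sub_eq_add_neg]

lemma continuous_slack : Continuous P.slack := continuous_const.sub P.Aadj.continuous

namespace IsStandard

variable (hP : P.IsStandard)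
include hP

lemma Aadj_ne_zero {h : H} (hh : h ≠ 0) : P.Aadj h ≠ 0 := fun h0 => hh <|
  (SeparatingDual.eq_zero_iff_forall_dual_eq_zero (R := ℝ) h).2 fun g => by
    obtain ⟨x, rfl⟩ := hP.surj g
    rw [← Aadj_apply, h0, zero_apply]

lemma nu_nonneg : 0 ≤ P.ν := by
  obtain ⟨x, hx⟩ := hP.cone.solid
  exact hP.barrier.nu_nonneg hx

/-- A feasible point slightly beyond y, on the side away from a strictly feasible y₀, makes s(y) a
convex combination of a point of K^* and the interior point s(y₀). -/
lemma slack_mem_interior {y : H} (hy : y ∈ interior P.Q) : P.slack y ∈ interior P.Kd := by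
  obtain ⟨-, y0, hy0⟩ := hP.feas
  have hc : Continuous fun t : ℝ => y + t • (y - y0) := by fun_prop
  have hev : ∀ᶠ t in 𝓝[>] (0 : ℝ), y + t • (y - y0) ∈ P.Q :=
    ((hc.tendsto 0).mono_left nhdsWithin_le_nhds).eventually
      (mem_of_superset (isOpen_interior.mem_nhds (by simpa using hy)) interior_subset)
  obtain ⟨t, ht, ht0⟩ := (hev.and self_mem_nhdsWithin).exists
  have ht0 : 0 < t := ht0
  have h1 : P.slack y = (1 + t)⁻¹ • (t • P.slack y0 + P.slack (y + t • (y - y0))) := by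
    rw [slack_add_smul, Aadj_sub_eq, eq_inv_smul_iff₀ (by positivity)]
    module
  rw [h1]
  exact isCone_Kd.smul_mem_interior
    (isCone_Kd.add_mem_interior (isCone_Kd.smul_mem_interior hy0 ht0) ht) (by positivity)

variable [FiniteDimensional ℝ E]

section Local

variable {s : StrongDual ℝ E} (hs : s ∈ interior P.Kd)
include hs

lemma isPSD_M : IsPSD (P.M s) := hP.barrier.isPSD_hess_dualBarrier hP.cone hs

lemma M_pos (u : StrongDual ℝ E) (hu : u ≠ 0) : 0 < P.M s u u :=
  hP.barrier.hess_dualBarrier_pos hP.cone hs u hu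

lemma M_self (u : StrongDual ℝ E) : P.M s s u = u (P.X s) :=
  hP.barrier.hess_dualBarrier_self hP.cone hs u

lemma apply_X : s (P.X s) = P.ν := hP.barrier.apply_primalPoint hP.cone hs

lemma X_smul {τ : ℝ} (hτ : 0 < τ) : P.X (τ • s) = τ⁻¹ • P.X s :=
  hP.barrier.primalPoint_smul hP.cone hs hτ

lemma abs_apply_le (u : StrongDual ℝ E) {p : E} (hp : p ∈ P.K) :
    |u p| ≤ opNorm (P.M s) u * s p := hP.barrier.abs_apply_le hP.cone hs u hp

lemma smul_add_mem {u : StrongDual ℝ E} {r : ℝ} (hr : opNorm (P.M s) u ≤ r) :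
    r • s + u ∈ P.Kd := hP.barrier.smul_add_mem_dualCone hP.cone hs hr

lemma smul_sub_mem {u : StrongDual ℝ E} {r : ℝ} (hr : opNorm (P.M s) u ≤ r) :
    r • s - u ∈ P.Kd := hP.barrier.smul_sub_mem_dualCone hP.cone hs hr

lemma opNorm_le_of_mem {p : StrongDual ℝ E} (hp : p ∈ P.Kd) : opNorm (P.M s) p ≤ p (P.X s) :=
  hP.barrier.opNorm_dualBarrier_le_of_mem hP.cone hs hp

lemma M_le_of_sub_mem {s' : StrongDual ℝ E} {c : ℝ} (hc : 0 < c) (h : s' - c • s ∈ P.Kd)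
    (u : StrongDual ℝ E) : P.M s' u u ≤ (c ^ 2)⁻¹ * P.M s u u :=
  hP.barrier.hess_dualBarrier_le_of_sub_mem hP.cone hs hP.curv hc h u

lemma X_le_of_sub_mem {s' h : StrongDual ℝ E} {c : ℝ} (hc : 0 < c)
    (hsub : s' - c • s ∈ P.Kd) (hh : h ∈ P.Kd) : h (P.X s') ≤ c⁻¹ * h (P.X s) :=
  hP.barrier.apply_primalPoint_le_of_sub_mem hP.cone hs hP.curv hc hsub hh

lemma X_add_le {p h : StrongDual ℝ E} (hp : p ∈ P.Kd) (hh : h ∈ P.Kd) :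
    h (P.X (s + p)) ≤ h (P.X s) :=
  hP.barrier.apply_primalPoint_add_le hP.cone hs hP.curv hp hh

lemma X_sub_le {p h : StrongDual ℝ E} (hp : p ∈ P.Kd) (hh : h ∈ P.Kd) :
    h (P.X s) - h (P.X (s + p)) ≤ P.M s p h :=
  hP.barrier.sub_apply_primalPoint_add_le hP.cone hs hP.curv hp hh

lemma sq_div_le {d : StrongDual ℝ E} (hd : s + d ∈ interior P.Kd) :
    opNorm (P.M s) d ^ 2 / (1 + opNorm (P.M s) d) ≤ d (P.X s) - d (P.X (s + d)) :=
  hP.barrier.sq_div_le_sub_apply hP.cone hs hP.curv hd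

lemma opNorm_M_self : opNorm (P.M s) s = √P.ν := by
  rw [opNorm, hP.M_self hs, hP.apply_X hs]

/-- Comparison of two local norms. -/
lemma opNorm_M_le_mul {s₁ : StrongDual ℝ E} (hs₁ : s₁ ∈ interior P.Kd) (u : StrongDual ℝ E) :
    opNorm (P.M s) u ≤ s₁ (P.X s) * opNorm (P.M s₁) u := by
  refine le_mul_opNorm (P.M s₁) (φ := opNorm (P.M s))
    (fun c u hc => by rw [opNorm_smul, abs_of_nonneg hc]) (fun u hu => ?_) u
  -- Both s₁ ± u lie in K^*, where the local norm is bounded by a linear function. In the sum of the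
  -- two bounds u cancels.
  have h1 := hP.opNorm_le_of_mem hs (hP.smul_add_mem hs₁ hu)
  have h2 := hP.opNorm_le_of_mem hs (hP.smul_sub_mem hs₁ hu)
  have h3 := (hP.isPSD_M hs).opNorm_sub_le ((1 : ℝ) • s₁ + u) ((1 : ℝ) • s₁ - u)
  have h4 : (1 : ℝ) • s₁ + u - ((1 : ℝ) • s₁ - u) = (2 : ℝ) • u := by module
  rw [h4, opNorm_smul, abs_of_pos two_pos] at h3
  simp only [one_smul, add_apply, sub_apply] at h1 h2 h3
  linarith

end Local

/-! ### The barrier of the dual feasible set -/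

section Feasible

variable {y : H} (hy : P.slack y ∈ interior P.Kd)
include hy

lemma hasFDerivAt_f : HasFDerivAt P.f (-(grad P.Fd (P.slack y)).comp P.Aadj) y := by
  have h1 : HasFDerivAt P.slack (-P.Aadj) y := P.Aadj.hasFDerivAt.const_sub P.c
  have h2 := (hasFDerivAt_grad (hP.barrier.contDiffAt_dualBarrier hP.cone hy)).comp y h1
  convert! h2 using 1
  ext; simp [Fd]

lemma grad_f (h : H) : grad P.f y h = P.Aadj h (P.X (P.slack y)) := by
  rw [grad, (hP.hasFDerivAt_f hy).fderiv]
  have := hP.barrier.grad_dualBarrier hP.cone hy (P.Aadj h)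
  simp only [neg_apply, ContinuousLinearMap.comp_apply]
  rw [show grad P.Fd (P.slack y) (P.Aadj h) = _ from this, neg_neg]
  rfl

lemma hess_f (h k : H) : hess P.f y h k = P.M (P.slack y) (P.Aadj h) (P.Aadj k) := by
  have h1 : HasFDerivAt P.slack (-P.Aadj) y := P.Aadj.hasFDerivAt.const_sub P.c
  have h2 := ((hasFDerivAt_hess (hP.barrier.contDiffAt_dualBarrier hP.cone hy)).comp y h1)
  have h3 : HasFDerivAt (fun z => grad P.f z k)
      (-((P.M (P.slack y)).comp (-P.Aadj)).flip (P.Aadj k)) y := by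
    have h4 := (h2.clm_apply (hasFDerivAt_const (P.Aadj k) y)).neg
    refine (h4.congr_of_eventuallyEq ?_).congr_fderiv ?_
    · filter_upwards [continuous_slack.continuousAt.eventually
        (isOpen_interior.mem_nhds hy)] with z hz
      rw [grad, (hP.hasFDerivAt_f hz).fderiv]
      rfl
    · ext z
      simp [M, Fd]
  have hd : DifferentiableAt ℝ (grad P.f) y := by
    have h5 : DifferentiableAt ℝ
        (fun z => -(grad P.Fd (P.slack z)).comp P.Aadj) y :=
      (h2.differentiableAt.clm_comp (differentiableAt_const P.Aadj)).neg
    refine h5.congr_of_eventuallyEq ?_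
    filter_upwards [continuous_slack.continuousAt.eventually
      (isOpen_interior.mem_nhds hy)] with z hz
    rw [grad, (hP.hasFDerivAt_f hz).fderiv]
  have h6 := hd.hasFDerivAt.clm_apply (hasFDerivAt_const k y)
  have := congrArg (fun L => L h) (h6.unique h3)
  change fderiv ℝ (grad P.f) y h k = _
  simpa using this

lemma opNorm_hess_f (h : H) :
    opNorm (hess P.f y) h = opNorm (P.M (P.slack y)) (P.Aadj h) := by
  rw [opNorm, opNorm, hP.hess_f hy]

lemma hess_f_pos (h : H) (hh : h ≠ 0) : 0 < hess P.f y h h := by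
  rw [hP.hess_f hy]
  exact hP.M_pos hy _ (hP.Aadj_ne_zero hh)

lemma isPSD_hess_f : IsPSD (hess P.f y) :=
  ⟨fun u w => by rw [hP.hess_f hy, hP.hess_f hy, (hP.isPSD_M hy).symm],
    fun u => by rw [hP.hess_f hy]; exact (hP.isPSD_M hy).nonneg _⟩

lemma abs_grad_f_le (h : H) : |grad P.f y h| ≤ √P.ν * opNorm (hess P.f y) h := by
  rw [hP.grad_f hy, ← hP.M_self hy, hP.opNorm_hess_f hy, ← hP.opNorm_M_self hy]
  exact (hP.isPSD_M hy).abs_apply_le _ _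

lemma add_mem_Q {h : H} (hh : opNorm (hess P.f y) h ≤ 1) : y + h ∈ P.Q := by
  rw [hP.opNorm_hess_f hy] at hh
  have := hP.smul_sub_mem hy hh
  rw [one_smul] at this
  change P.slack (y + h) ∈ P.Kd
  rwa [slack_add]

variable [FiniteDimensional ℝ H]

lemma hess_f_v : hess P.f y (P.v y) = grad P.f y := apply_inverse_of_pos (hP.hess_f_pos hy) _

lemma opNorm_v_le : opNorm (hess P.f y) (P.v y) ≤ √P.ν := by
  have h1 := (hP.isPSD_hess_f hy).sq_opNorm (P.v y)
  rw [hP.hess_f_v hy] at h1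
  have h2 := (le_abs_self _).trans (hP.abs_grad_f_le hy (P.v y))
  rcases (opNorm_nonneg (hess P.f y) (P.v y)).eq_or_lt with h0 | h0
  · rw [← h0]; exact Real.sqrt_nonneg _
  · nlinarith

/-- Membership in a scaled Dikin ellipsoid bounds the cone measure by ‖v‖_y ≤ √ν; with α ≤ 2 this is
the source of the factor 1 + 2√ν in the constants. -/
lemma coneMeasure_v_le : coneMeasure P.Kd (P.slack y) (-(P.Aadj (P.v y))) ≤ √P.ν := by
  refine csInf_le ⟨0, fun ρ hρ => hρ.1⟩ ⟨Real.sqrt_nonneg _, hP.smul_sub_mem hy ?_⟩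
  rw [opNorm_neg, ← hP.opNorm_hess_f hy]
  exact hP.opNorm_v_le hy

end Feasible

/-! ### The central path -/

section Central

variable [FiniteDimensional ℝ H]

/-- On {Ax = b} the functional s(y₀) differs from c by a constant, and it is coercive on K.
Minimizing s(y₀)/μ + F there gives x_μ; stationarity along ker A yields the multiplier. -/
lemma exists_isCentral {μ : ℝ} (hμ : 0 < μ) : ∃ z, P.IsCentral μ z := by
  obtain ⟨⟨x0, hx0, hAx0⟩, y0, hy0⟩ := hP.feas
  obtain ⟨x, ⟨hxb, hx⟩, hmin⟩ := hP.barrier.exists_isMinOn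
    (isCone_Kd.smul_mem_interior hy0 (inv_pos.2 hμ)) (S := {x | P.A x = P.b})
    (isClosed_eq P.A.continuous continuous_const) ⟨x0, hAx0, hx0⟩
  have hxb : P.A x = P.b := hxb
  set φ : StrongDual ℝ E := μ⁻¹ • P.slack y0 + grad P.F x with hφ
  have hker : ∀ h, P.A h = 0 → φ h = 0 := fun h hh => by
    have hline := hasDerivAt_line x h 0
    have hmem : ∀ᶠ t : ℝ in 𝓝 0, x + t • h ∈ interior (P.K : Set E) :=
      hline.continuousAt.eventually (isOpen_interior.mem_nhds (by simpa using hx))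
    have hloc : IsLocalMin (fun t : ℝ => (μ⁻¹ • P.slack y0) (x + t • h) + P.F (x + t • h)) 0 := by
      filter_upwards [hmem] with t ht
      simpa using hmin (x + t • h) ⟨by simp [hxb, hh], ht⟩
    have hd := hloc.hasDerivAt_eq_zero (((μ⁻¹ • P.slack y0).hasFDerivAt.comp_hasDerivAt 0 hline).add
      (hasDerivAt_line_apply (by simpa using hP.barrier.contDiffAt hx)))
    simpa [hφ] using hd
  obtain ⟨R, hR⟩ := LinearMap.exists_rightInverse_of_surjective
    (P.A : E →ₗ[ℝ] StrongDual ℝ H) (LinearMap.range_eq_top.2 hP.surj)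
  let ψ : StrongDual ℝ (StrongDual ℝ H) := LinearMap.toContinuousLinearMap
    ((φ : E →ₗ[ℝ] ℝ).comp R)
  have hψ : ∀ x, P.A x (fromBidual ψ) = φ x := fun x => by
    rw [apply_fromBidual]
    have h1 : P.A (R (P.A x)) = P.A x := congrArg (fun L => L (P.A x)) hR
    have h2 := hker (R (P.A x) - x) (by rw [map_sub, h1, sub_self])
    rw [map_sub, sub_eq_zero] at h2
    exact h2
  refine ⟨(x, -(μ • grad P.F x), y0 + μ • fromBidual ψ), hx, hxb, ?_, rfl⟩
  ext z
  have h1 := hψ z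
  simp only [hφ, add_apply, smul_apply, smul_eq_mul, slack, sub_apply, Aadj_apply] at h1
  simp only [add_apply, smul_apply, smul_eq_mul, Aadj_apply, map_add, map_smul, h1]
  field_simp
  ring

variable {μ : ℝ} (hμ : 0 < μ)
include hμ

lemma isCentral_centralPath : P.IsCentral μ (P.centralPath μ) :=
  Classical.epsilon_spec (hP.exists_isCentral hμ)

lemma slack_central : P.slack (P.centralPath μ).2.2 = (P.centralPath μ).2.1 := by
  obtain ⟨-, -, h1, h2⟩ := hP.isCentral_centralPath hμ
  rw [h2, slack, ← h1]; abel

lemma central_eq_smul :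
    (P.centralPath μ).2.1 = μ • (-grad P.F (P.centralPath μ).1) := by
  rw [(hP.isCentral_centralPath hμ).2.2.2, smul_neg]

lemma central_mem_interior : (P.centralPath μ).2.1 ∈ interior P.Kd := by
  rw [hP.central_eq_smul hμ]
  exact isCone_Kd.smul_mem_interior
    (hP.barrier.neg_grad_mem_interior hP.cone (hP.isCentral_centralPath hμ).1) hμ

lemma X_central : P.X (P.centralPath μ).2.1 = μ⁻¹ • (P.centralPath μ).1 := by
  have hx := (hP.isCentral_centralPath hμ).1
  rw [hP.central_eq_smul hμ,
    hP.X_smul (hP.barrier.neg_grad_mem_interior hP.cone hx) hμ]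
  congr 1
  exact hP.barrier.primalPoint_eq hP.cone hx (neg_neg _).symm

lemma central_gap : (P.centralPath μ).2.1 (P.centralPath μ).1 = μ * P.ν := by
  have h := hP.apply_X (hP.central_mem_interior hμ)
  rw [hP.X_central hμ, map_smul, smul_eq_mul] at h
  field_simp at h
  linarith

lemma slack_apply_central (y : H) :
    P.slack y (P.centralPath μ).1 = P.c (P.centralPath μ).1 - P.b y := by
  rw [slack, sub_apply, Aadj_apply, (hP.isCentral_centralPath hμ).2.1]

omit hμ in
lemma X_central_one : P.X (P.centralPath 1).2.1 = (P.centralPath 1).1 := by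
  rw [hP.X_central one_pos, inv_one, one_smul]

/-- Orthogonality: x₁ - x_μ ∈ ker A and s₁ - s_μ is in the range of A^*, so ⟨s₁, x_μ⟩ + ⟨s_μ, x₁⟩ =
ν + μν. The second summand is nonnegative. -/
lemma central_one_apply_le :
    (P.centralPath 1).2.1 (P.centralPath μ).1 ≤ P.ν * (1 + μ) := by
  have e1 := hP.slack_apply_central hμ (P.centralPath 1).2.2
  have e2 := hP.slack_apply_central hμ (P.centralPath μ).2.2
  have e3 := hP.slack_apply_central one_pos (P.centralPath 1).2.2
  have e4 := hP.slack_apply_central one_pos (P.centralPath μ).2.2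
  rw [hP.slack_central hμ] at e2 e4
  rw [hP.slack_central one_pos] at e1 e3
  have g1 := hP.central_gap hμ
  have g2 := hP.central_gap one_pos
  have h0 := interior_subset (hP.central_mem_interior hμ) _
    (interior_subset (hP.isCentral_centralPath one_pos).1)
  linarith

omit hμ in
/-- The norm `‖·‖_G` is the local dual norm at the central point with `μ = 1`. -/
lemma opNorm_G (h : H) :
    opNorm P.G h = opNorm (P.M (P.centralPath 1).2.1) (P.Aadj h) := by
  rw [opNorm, opNorm]
  congr 1
  have := hP.barrier.hess_dualBarrier_apply hP.cone (hP.central_mem_interior one_pos)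
    (P.Aadj h) (P.Aadj h)
  refine Eq.trans ?_ this.symm
  change P.A (P.B.inverse (P.Aadj h)) h = _
  rw [← Aadj_apply, B]
  conv_lhs => rw [← hP.X_central_one]
  rfl

omit hμ in
-- The local norm at s₁ is dual to ‖·‖_B, so the hypothesis with σ_d becomes a bound on the pairing
-- with an arbitrary u.
lemma abs_apply_fromBidual_le (u : StrongDual ℝ E) (ψ : StrongDual ℝ (StrongDual ℝ E)) :
    |ψ u| ≤ opNorm P.B (fromBidual ψ) * opNorm (P.M (P.centralPath 1).2.1) u := by
  have hs := hP.central_mem_interior one_pos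
  have h1 := hP.barrier.opNorm_inverse hP.cone hs u
  have hx := hP.X_central_one
  rw [X] at hx
  rw [hx] at h1
  have hx1 := (hP.isCentral_centralPath one_pos).1
  have h2 := (hP.barrier.isPSD_hess hx1).abs_apply_le
    ((hess P.F (P.centralPath 1).1).inverse u) (fromBidual ψ)
  rw [apply_inverse_of_pos (hP.barrier.hess_pos hP.cone hx1), apply_fromBidual, h1, mul_comm] at h2
  exact h2

end Central

end IsStandard

end ConicProblem

/-! ### Step lengths and constants -/

section Steps

variable {abar α : ℝ}

lemma eta_mem (h0 : 0 ≤ α) (h1 : α < abar) : 0 ≤ eta abar α ∧ eta abar α < abar := by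
  unfold eta
  split_ifs <;> constructor <;> linarith

lemma one_le_xi (h0 : 0 ≤ α) (h1 : α < abar) : 1 ≤ xi abar α := by
  have : 0 ≤ α * abar / (abar - α) :=
    div_nonneg (mul_nonneg h0 (h0.trans h1.le)) (by linarith)
  unfold xi
  linarith

/-- The fraction in ξ grows at most fourfold under doubling precisely when 3α ≤ `abar`, and under
bisection precisely when 3α ≥ `abar`; hence the switch at `abar`/3. -/
lemma xi_eta_le (h0 : 0 ≤ α) (h1 : α < abar) : xi abar (eta abar α) ≤ 4 * xi abar α := by
  have ha : 0 < abar := h0.trans_lt h1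
  have hd : 0 < abar - α := by linarith
  suffices h : eta abar α * abar / (abar - eta abar α) ≤ 4 * (α * abar / (abar - α)) by
    unfold xi; linarith
  have hd' : 0 < abar - eta abar α := by linarith [(eta_mem h0 h1).2]
  rw [← mul_div_assoc, div_le_div_iff₀ hd' hd]
  have : 0 ≤ abar * α := by positivity
  unfold eta
  split_ifs with h
  · nlinarith
  · nlinarith [mul_nonneg (mul_nonneg ha.le hd.le) (by linarith : 0 ≤ 3 * α - abar)]

lemma kappa_eq (ν γd σd : ℝ) : kappa ν γd σd = 2 * (kappa1 ν / γd) * (σd + 6 / 25 * ν ^ 2) := by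
  rw [kappa, kappa2]; ring

end Steps

namespace ConicProblem

variable {E H : Type*} [NormedAddCommGroup E] [NormedSpace ℝ E]
  [NormedAddCommGroup H] [NormedSpace ℝ H] {P : ConicProblem E H}

namespace IsStandard

variable [FiniteDimensional ℝ E] [FiniteDimensional ℝ H] (hP : P.IsStandard)
include hP

/-! ### Maximal steps -/

section MaxStep

variable {y : H} (hy : P.slack y ∈ interior P.Kd) {abar : ℝ} (hstep : P.IsMaxStep y abar)
include hy hstep

omit [FiniteDimensional ℝ E] hP [FiniteDimensional ℝ H] in
lemma v_ne_zero : P.v y ≠ 0 := fun h0 => by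
  have : |abar| + 1 ≤ abar := hstep.2
    ⟨by positivity, by rw [h0, smul_zero, add_zero]; exact (interior_subset hy : P.slack y ∈ P.Kd)⟩
  linarith [le_abs_self abar]

omit [FiniteDimensional ℝ H] in
-- The Dikin ellipsoid gives `abar` ≥ 1/‖v‖_y, so the first trial step is at most `abar`/6; both
-- update rules preserve the strict inequality.
lemma trial_mem (i : ℕ) : 0 ≤ P.trial abar y i ∧ P.trial abar y i < abar := by
  induction i with
  | zero =>
    have hv : 0 < opNorm (hess P.f y) (P.v y) :=
      Real.sqrt_pos.2 (hP.hess_f_pos hy _ (v_ne_zero hy hstep))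
    have h1 : 1 / opNorm (hess P.f y) (P.v y) ≤ abar := hstep.2 ⟨by positivity,
      hP.add_mem_Q hy (by rw [opNorm_smul, abs_of_pos (by positivity), div_mul_cancel₀ _ hv.ne'])⟩
    have h2 : 0 < 1 / opNorm (hess P.f y) (P.v y) := by positivity
    have h3 : 0 < min 1 (1 / opNorm (hess P.f y) (P.v y)) := lt_min one_pos h2
    have h4 := min_le_right 1 (1 / opNorm (hess P.f y) (P.v y))
    simp only [trial, Function.iterate_zero, id]
    constructor <;> linarith
  | succ n ih =>
    have : P.trial abar y (n + 1) = eta abar (P.trial abar y n) := by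
      simp only [trial, Function.iterate_succ_apply']
    rw [this]
    exact eta_mem ih.1 ih.2

end MaxStep

/-! ### Points near the central path -/

section Near

variable {μ : ℝ} (hμ : 0 < μ) (hμ1 : μ ≤ 1) {y : H} (hy : y ∈ P.nbhd μ (μ / 25))
include hμ hμ1 hy

omit hμ hμ1 in
lemma abs_grad_sub_le (h : H) :
    |grad P.f y h - μ⁻¹ * P.b h| ≤ μ / 25 * opNorm (hess P.f y) h := by
  have hs := hP.slack_mem_interior hy.1
  have h1 := (hP.isPSD_hess_f hs).abs_le_opDualNorm_mul (hP.hess_f_pos hs)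
    (grad P.f y - (1 / μ) • P.b) h
  simp only [sub_apply, smul_apply, smul_eq_mul, one_div] at h1
  refine h1.trans (mul_le_mul_of_nonneg_right ?_ (opNorm_nonneg _ _))
  simpa using hy.2

/-- Strong monotonicity of ∇F_* against the residual gives r²/(1+r) ≤ (μ/25) r, so r ≤ (μ/25)/(1 -
μ/25) ≤ μ/24 for μ ≤ 1. -/
lemma opNorm_central_sub_le :
    opNorm (hess P.f y) ((P.centralPath μ).2.2 - y) ≤ μ / 24 := by
  have hs := hP.slack_mem_interior hy.1
  have hsm := hP.central_mem_interior hμ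
  set ym := (P.centralPath μ).2.2 with hym
  have hd : P.slack y + -P.Aadj (ym - y) = (P.centralPath μ).2.1 := by
    rw [Aadj_sub_eq, ← hP.slack_central hμ]; abel
  have h1 := hP.sq_div_le hs (d := -P.Aadj (ym - y)) (by rwa [hd])
  rw [hd, opNorm_neg, ← hP.opNorm_hess_f hs, hP.X_central hμ] at h1
  simp only [neg_apply, map_smul, smul_eq_mul, ← hP.grad_f hs] at h1
  rw [Aadj_apply, (hP.isCentral_centralPath hμ).2.1] at h1
  have h2 := (abs_le.1 (hP.abs_grad_sub_le hy (ym - y))).1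
  set r := opNorm (hess P.f y) (ym - y)
  have hr0 : 0 ≤ r := opNorm_nonneg _ _
  have h3 : r ^ 2 ≤ μ / 25 * r * (1 + r) := by
    rw [← div_le_iff₀ (by positivity)]
    linarith
  rcases hr0.eq_or_lt with h0 | h0
  · rw [← h0]; positivity
  · have h4 : r ≤ μ / 25 * (1 + r) := by
      have : r * r ≤ r * (μ / 25 * (1 + r)) := by nlinarith
      exact le_of_mul_le_mul_left this h0
    nlinarith

lemma opNorm_central_slack_sub_le :
    opNorm (P.M (P.slack y)) ((P.centralPath μ).2.1 - P.slack y) ≤ μ / 24 := by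
  have := hP.opNorm_central_sub_le hμ hμ1 hy
  rw [hP.opNorm_hess_f (hP.slack_mem_interior hy.1), Aadj_sub_eq, hP.slack_central hμ,
    ← opNorm_neg, neg_sub] at this
  exact this

/-- Together with `central_sub_smul_mem`, this sandwiches s(y) and s_μ in the cone order, the form
in which negative curvature compares Hessians and gradients. -/
lemma slack_sub_smul_mem :
    P.slack y - (1 + μ / 24)⁻¹ • (P.centralPath μ).2.1 ∈ P.Kd := by
  have h1 := hP.smul_sub_mem (hP.slack_mem_interior hy.1)
    (hP.opNorm_central_slack_sub_le hμ hμ1 hy)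
  have h2 := isCone_Kd.smul_mem (1 + μ / 24)⁻¹ (by positivity) _ h1
  convert! h2 using 1
  have h3 : P.slack y = ((1 + μ / 24)⁻¹ * (1 + μ / 24)) • P.slack y := by
    rw [inv_mul_cancel₀ (by positivity), one_smul]
  conv_lhs => enter [1]; rw [h3]
  module

lemma central_sub_smul_mem :
    (P.centralPath μ).2.1 - (1 - μ / 24) • P.slack y ∈ P.Kd := by
  have h1 := hP.smul_add_mem (hP.slack_mem_interior hy.1)
    (hP.opNorm_central_slack_sub_le hμ hμ1 hy)
  convert! h1 using 1
  module

lemma apply_X_slack_le {h : StrongDual ℝ E} (hh : h ∈ P.Kd) :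
    h (P.X (P.slack y)) ≤ (1 + μ / 24) * (μ⁻¹ * h (P.centralPath μ).1) := by
  have := hP.X_le_of_sub_mem (hP.central_mem_interior hμ) (by positivity)
    (hP.slack_sub_smul_mem hμ hμ1 hy) hh
  rwa [inv_inv, hP.X_central hμ, map_smul, smul_eq_mul] at this

lemma central_one_apply_X_le :
    (P.centralPath 1).2.1 (P.X (P.slack y)) ≤ 25 / 24 * (2 * P.ν * μ⁻¹) := by
  have h1 := hP.apply_X_slack_le hμ hμ1 hy
    (interior_subset (hP.central_mem_interior one_pos))
  have h2 := hP.central_one_apply_le hμ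
  have hν := hP.nu_nonneg
  have h3 : μ⁻¹ * (P.centralPath 1).2.1 (P.centralPath μ).1 ≤ μ⁻¹ * (2 * P.ν) :=
    mul_le_mul_of_nonneg_left (h2.trans (by nlinarith)) (by positivity)
  have h4 : (1 + μ / 24) * (μ⁻¹ * (P.centralPath 1).2.1 (P.centralPath μ).1) ≤
      25 / 24 * (μ⁻¹ * (2 * P.ν)) :=
    (mul_le_mul_of_nonneg_left h3 (by positivity)).trans
      (mul_le_mul_of_nonneg_right (by linarith) (by positivity))
  linarith

/-- With r = μ/24 ≤ 1/24 the sandwich gives Hessian ratios between (1+r)⁻² ≥ 1 - 2r and (1-r)⁻² ≤ 1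
+ 11r/5. -/
lemma abs_M_central_sub_le (u : StrongDual ℝ E) :
    |P.M (P.centralPath μ).2.1 u u - P.M (P.slack y) u u| ≤
      11 / 5 * (μ / 24) * P.M (P.slack y) u u := by
  have hs := hP.slack_mem_interior hy.1
  have h1 := hP.M_le_of_sub_mem hs (by linarith) (hP.central_sub_smul_mem hμ hμ1 hy) u
  have h2 := hP.M_le_of_sub_mem (hP.central_mem_interior hμ) (by positivity)
    (hP.slack_sub_smul_mem hμ hμ1 hy) u
  have h0 := (hP.isPSD_M hs).nonneg u
  set m := P.M (P.slack y) u u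
  set m' := P.M (P.centralPath μ).2.1 u u
  set r := μ / 24 with hr
  have hr0 : 0 ≤ r := by positivity
  have hr1 : r ≤ 1 / 24 := by rw [hr]; linarith
  rw [inv_pow, inv_inv] at h2
  rw [abs_le]
  constructor
  · have h3 : (1 - 2 * r) * m ≤ m' := by
      have h4 : (1 - 2 * r) * (1 + r) ^ 2 ≤ 1 := by nlinarith [pow_nonneg hr0 3, sq_nonneg r]
      have h5 : 0 ≤ m' := by
        by_contra! hc
        nlinarith [mul_neg_of_pos_of_neg (by positivity : 0 < (1 + r) ^ 2) hc]
      calc (1 - 2 * r) * m ≤ (1 - 2 * r) * ((1 + r) ^ 2 * m') :=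
            mul_le_mul_of_nonneg_left h2 (by linarith)
        _ = ((1 - 2 * r) * (1 + r) ^ 2) * m' := by ring
        _ ≤ 1 * m' := mul_le_mul_of_nonneg_right h4 h5
        _ = m' := one_mul _
    nlinarith [mul_nonneg hr0 h0]
  · have h3 : ((1 - r) ^ 2)⁻¹ ≤ 1 + 11 / 5 * r := by
      have h6 : 0 < (1 - r) ^ 2 := pow_pos (by linarith) 2
      rw [inv_le_iff_one_le_mul₀ h6]
      nlinarith [pow_nonneg hr0 3, mul_nonneg hr0 (by linarith : 0 ≤ 1 / 24 - r)]
    have h4 := mul_le_mul_of_nonneg_right h3 h0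
    linarith

/-! ### Optimality gap, sharpness and the predictor step -/

variable {ystar : H} (hystar : P.IsDualOptimal ystar)
include hystar

omit hμ1 hy in
lemma slack_star_apply_central_le : P.slack ystar (P.centralPath μ).1 ≤ μ * P.ν := by
  have h1 := hP.slack_apply_central hμ ystar
  have h2 := hP.slack_apply_central hμ (P.centralPath μ).2.2
  rw [hP.slack_central hμ, hP.central_gap hμ] at h2
  have h3 := hystar.2 (P.centralPath μ).2.2 (by
    change P.slack _ ∈ P.Kd
    rw [hP.slack_central hμ]
    exact interior_subset (hP.central_mem_interior hμ))
  linarith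

lemma opNorm_slack_star_le : opNorm (P.M (P.slack y)) (P.slack ystar) ≤ 25 / 24 * P.ν := by
  have h1 := hP.opNorm_le_of_mem (hP.slack_mem_interior hy.1) hystar.1
  have h2 := hP.apply_X_slack_le hμ hμ1 hy hystar.1
  have h3 : μ⁻¹ * P.slack ystar (P.centralPath μ).1 ≤ P.ν := by
    rw [inv_mul_le_iff₀ hμ]
    exact hP.slack_star_apply_central_le hμ hystar
  have h4 : (1 + μ / 24) * (μ⁻¹ * P.slack ystar (P.centralPath μ).1) ≤ 25 / 24 * P.ν :=
    (mul_le_mul_of_nonneg_left h3 (by positivity)).trans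
      (mul_le_mul_of_nonneg_right (by linarith) hP.nu_nonneg)
  linarith

/-- The gap at y_μ is at most μν because ⟨s_*, x_μ⟩ ≥ 0. The remainder ⟨b, y_μ - y⟩ is compared with
μ⟨∇f(y), y_μ - y⟩, where ‖∇f(y)‖_y ≤ √ν and ‖y_μ - y‖_y ≤ 1/24. -/
lemma gap_le : P.b ystar - P.b y ≤ kappa1 P.ν * μ := by
  have hs := hP.slack_mem_interior hy.1
  have h0 : 0 ≤ P.slack ystar (P.centralPath μ).1 :=
    hystar.1 _ (interior_subset (hP.isCentral_centralPath hμ).1)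
  have h1 := hP.slack_apply_central hμ ystar
  have h2 := hP.slack_apply_central hμ (P.centralPath μ).2.2
  rw [hP.slack_central hμ, hP.central_gap hμ] at h2
  have h3 := hP.abs_grad_sub_le hy ((P.centralPath μ).2.2 - y)
  have h4 := hP.abs_grad_f_le hs ((P.centralPath μ).2.2 - y)
  have h5 := hP.opNorm_central_sub_le hμ hμ1 hy
  set h := (P.centralPath μ).2.2 - y with hh
  have hr0 := opNorm_nonneg (hess P.f y) h
  set r := opNorm (hess P.f y) h
  have h6 : P.b h = μ * (μ⁻¹ * P.b h) := by field_simp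
  have h7 : μ⁻¹ * P.b h ≤ (1 / 25 + √P.ν) / 24 := by
    have e1 := (abs_le.1 h3).1
    have e2 := (abs_le.1 h4).2
    have e3 := Real.sqrt_nonneg P.ν
    have e4 : (√P.ν + μ / 25) * r ≤ (√P.ν + 1 / 25) * (1 / 24) :=
      mul_le_mul (by linarith) (by linarith) hr0 (by positivity)
    linarith
  have h8 : P.b h ≤ μ * ((1 / 25 + √P.ν) / 24) := by
    rw [h6]; exact mul_le_mul_of_nonneg_left h7 hμ.le
  rw [hh, map_sub] at h8
  have h9 : kappa1 P.ν = P.ν + (1 / 25 + √P.ν) / 24 := by rw [kappa1]; ring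
  rw [h9]
  linarith

variable {σd : ℝ} (hbound : P.BoundedHessianAlongPath ystar σd)

omit hystar hP [FiniteDimensional ℝ H] [FiniteDimensional ℝ E] hμ hμ1 hy in
include hbound in
lemma sigma_nonneg : 0 ≤ σd := (opNorm_nonneg _ _).trans (hbound 1 one_pos le_rfl)

include hbound in
-- Passing from s_μ to s(y) costs a relative error O(μ), while the local norm at s(y) exceeds that
-- at s₁ by a factor O(1/μ). The powers of μ cancel, leaving (11/5)(1/24)(25/24)²·2·ν² ≤ (6/25)ν².
lemma abs_M_slack_star_le (u : StrongDual ℝ E) :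
    |P.M (P.slack y) (P.slack ystar) u| ≤
      (σd + 6 / 25 * P.ν ^ 2) * opNorm (P.M (P.centralPath 1).2.1) u := by
  have hs := hP.slack_mem_interior hy.1
  have hsm := hP.central_mem_interior hμ
  have hν := hP.nu_nonneg
  set n1 := opNorm (P.M (P.centralPath 1).2.1) u with hn1
  have hn0 : 0 ≤ n1 := opNorm_nonneg _ _
  have h1 : |P.M (P.centralPath μ).2.1 (P.slack ystar) u| ≤ σd * n1 :=
    (hP.abs_apply_fromBidual_le u _).trans
      (mul_le_mul_of_nonneg_right (hbound μ hμ hμ1) hn0)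
  have h2 := (hP.isPSD_M hs).abs_sub_apply_le (hP.isPSD_M hsm) (hP.isPSD_M hs)
    (by positivity) (hP.abs_M_central_sub_le hμ hμ1 hy) (P.slack ystar) u
  have h3 := hP.opNorm_slack_star_le hμ hμ1 hy hystar
  have h4 : opNorm (P.M (P.slack y)) u ≤ 25 / 24 * (2 * P.ν * μ⁻¹) * n1 :=
    (hP.opNorm_M_le_mul hs (hP.central_mem_interior one_pos) u).trans
      (mul_le_mul_of_nonneg_right (hP.central_one_apply_X_le hμ hμ1 hy) hn0)
  have h5 : opNorm (P.M (P.slack y)) (P.slack ystar) * opNorm (P.M (P.slack y)) u ≤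
      25 / 24 * P.ν * (25 / 24 * (2 * P.ν * μ⁻¹) * n1) :=
    mul_le_mul h3 h4 (opNorm_nonneg _ _) (by positivity)
  have h6 : 11 / 5 * (μ / 24) * (25 / 24 * P.ν * (25 / 24 * (2 * P.ν * μ⁻¹) * n1)) =
      11 / 5 / 24 * (25 / 24) ^ 2 * 2 * (P.ν ^ 2 * n1) := by field_simp
  have h7 := mul_le_mul_of_nonneg_left h5 (by positivity : 0 ≤ 11 / 5 * (μ / 24))
  rw [h6] at h7
  have h8 : 0 ≤ P.ν ^ 2 * n1 := by positivity
  have h9 := h2.trans h7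
  rw [abs_le] at h1 h9 ⊢
  constructor <;> linarith [h1.1, h1.2, h9.1, h9.2]

variable {γd : ℝ} (hsharp : P.SharpDualMaximum ystar γd)
include hsharp

omit hμ hμ1 hystar in
/-- Sharpness bounds the size of the Dikin ellipsoid by the optimality gap. -/
lemma mul_opNorm_G_le_gap (h : H) :
    γd * opNorm P.G h ≤ (P.b ystar - P.b y) * opNorm (hess P.f y) h := by
  have hs := hP.slack_mem_interior hy.1
  refine le_mul_opNorm (hess P.f y) (φ := fun h => γd * opNorm P.G h)
    (fun c u hc => by rw [opNorm_smul, abs_of_nonneg hc]; ring) (fun h hh => ?_) h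
  -- Sharpness is applied at both feasible points y ± h. In the sum ⟨b, h⟩ cancels and only the gap
  -- at y remains.
  have h1 := hsharp.2 _ (hP.add_mem_Q hs hh)
  have h2 := hsharp.2 _ (hP.add_mem_Q hs (h := -h) (by rwa [opNorm_neg]))
  have h3 := (hP.isPSD_M (hP.central_mem_interior one_pos)).opNorm_sub_le
    (P.Aadj (y + h - ystar)) (P.Aadj (y + -h - ystar))
  rw [← map_sub, ← hP.opNorm_G, ← hP.opNorm_G, ← hP.opNorm_G,
    show y + h - ystar - (y + -h - ystar) = (2 : ℝ) • h by module, opNorm_smul,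
    abs_of_pos two_pos] at h3
  have h4 := mul_le_mul_of_nonneg_left h3 hsharp.1.le
  simp only [map_add, map_neg] at h1 h2
  linarith

lemma opNorm_G_le (h : H) :
    opNorm P.G h ≤ kappa1 P.ν / γd * μ * opNorm (hess P.f y) h := by
  have h1 := hP.mul_opNorm_G_le_gap hy hsharp h
  have h2 := mul_le_mul_of_nonneg_right (hP.gap_le hμ hμ1 hy hystar)
    (opNorm_nonneg (hess P.f y) h)
  have h3 : kappa1 P.ν / γd * μ * opNorm (hess P.f y) h =
      kappa1 P.ν * μ * opNorm (hess P.f y) h / γd := by ring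
  rw [h3, le_div_iff₀ hsharp.1]
  linarith

include hbound in
/-- The full predictor step leads to a neighbourhood of the optimal solution. -/
lemma opNorm_predictor_sub_le :
    opNorm (hess P.f y) (y + P.v y - ystar) ≤ kappa P.ν γd σd * μ / 2 := by
  have hs := hP.slack_mem_interior hy.1
  set q := y + P.v y - ystar with hq
  -- Homogeneity gives ∇f(y) = A∇²F_*(s)s, while ∇²f(y)(y - y_*) = A∇²F_*(s)(s_* - s). The terms
  -- with s cancel, so only s_* acts on q.
  have h1 : hess P.f y q q = P.M (P.slack y) (P.slack ystar) (P.Aadj q) := by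
    have e1 : hess P.f y q q = hess P.f y (y - ystar) q + hess P.f y (P.v y) q := by
      rw [← add_apply, ← map_add]; congr 2; rw [hq]; abel
    rw [e1, hP.hess_f_v hs, hP.hess_f hs, hP.grad_f hs, ← hP.M_self hs, Aadj_sub_eq, map_sub,
      sub_apply]
    ring
  have h2 := (le_abs_self _).trans (hP.abs_M_slack_star_le hμ hμ1 hy hystar hbound (P.Aadj q))
  rw [← h1, ← (hP.isPSD_hess_f hs).sq_opNorm, ← hP.opNorm_G] at h2
  have h3 := hP.opNorm_G_le hμ hμ1 hy hystar hsharp q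
  have hS : 0 ≤ σd + 6 / 25 * P.ν ^ 2 := by have := sigma_nonneg hbound; positivity
  have h4 := mul_le_mul_of_nonneg_left h3 hS
  have hk : kappa P.ν γd σd * μ / 2 = (σd + 6 / 25 * P.ν ^ 2) * (kappa1 P.ν / γd * μ) := by
    rw [kappa_eq]; ring
  rw [hk]
  have h5 := opNorm_nonneg (hess P.f y) q
  set r := opNorm (hess P.f y) q
  rcases h5.eq_or_lt with h0 | h0
  · rw [← h0]
    have hκ1 : 0 ≤ kappa1 P.ν := by
      have := hP.nu_nonneg
      unfold kappa1; positivity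
    have := hsharp.1
    positivity
  · refine le_of_mul_le_mul_right ?_ h0
    linarith

variable {abar : ℝ} (hstep : P.IsMaxStep y abar)
include hstep

omit hμ hμ1 hystar in
lemma gap_pos : 0 < P.b ystar - P.b y := by
  have hs := hP.slack_mem_interior hy.1
  have hv := v_ne_zero hs hstep
  have h1 := hP.mul_opNorm_G_le_gap hy hsharp (P.v y)
  have h2 : 0 < opNorm P.G (P.v y) := by
    rw [hP.opNorm_G]
    exact Real.sqrt_pos.2 (hP.M_pos (hP.central_mem_interior one_pos) _ (hP.Aadj_ne_zero hv))
  have h3 := mul_pos hsharp.1 h2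
  by_contra! hc
  have := mul_nonneg (neg_nonneg.2 hc) (opNorm_nonneg (hess P.f y) (P.v y))
  linarith

include hbound in
lemma abs_maxStep_sub_one_le : |abar - 1| ≤ abar * (kappa P.ν γd σd * μ / 2) := by
  have hs := hP.slack_mem_interior hy.1
  have hq := hP.opNorm_predictor_sub_le hμ hμ1 hy hystar hbound hsharp
  set q := y + P.v y - ystar with hqd
  set δ := kappa P.ν γd σd * μ / 2
  have hδ : 0 ≤ δ := (opNorm_nonneg _ _).trans hq
  -- At α = 1/(1+δ) the slack is α[(δs(y) - A^*q) + s_*], a sum of two elements of K^*.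
  have hlow : 1 / (1 + δ) ≤ abar := by
    refine hstep.2 ⟨by positivity, ?_⟩
    change P.slack _ ∈ P.Kd
    have h1 := hP.smul_sub_mem hs (u := P.Aadj q) (r := δ) (by rwa [← hP.opNorm_hess_f hs])
    have h2 := isCone_Kd.smul_mem (1 / (1 + δ)) (by positivity) _
      (isCone_Kd.add_mem _ h1 _ hystar.1)
    convert! h2 using 1
    have e1 : P.Aadj (P.v y) = P.Aadj q + P.slack y - P.slack ystar := by
      have : P.v y = q + (ystar - y) := by rw [hqd]; abel
      rw [this, map_add, Aadj_sub_eq ystar y]; abel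
    have e2 : P.slack y = (1 / (1 + δ) * (1 + δ)) • P.slack y := by
      rw [one_div_mul_cancel (by positivity), one_smul]
    rw [slack_add_smul, e1]
    conv_lhs => enter [1]; rw [e2]
    module
  have ha : 0 ≤ abar := hstep.1.1
  rw [abs_le]
  constructor
  · rw [div_le_iff₀ (by positivity)] at hlow
    linarith
  · have hgap := hP.gap_pos hy hsharp hstep
    have h1 := hystar.2 _ hstep.1.2
    -- Optimality at the feasible points y - h with ‖h‖_y ≤ 1 bounds -⟨b, ·⟩ by the gap. Both sides
    -- of the final inequality scale with the gap, which is divided out.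
    have h2 : -P.b q ≤ (P.b ystar - P.b y) * δ := by
      refine (le_mul_opNorm (hess P.f y) (φ := fun h => -P.b h)
        (fun c u _ => by simp) (fun h hh => ?_) q).trans
        (mul_le_mul_of_nonneg_left hq hgap.le)
      have := hystar.2 _ (hP.add_mem_Q hs (h := -h) (by rwa [opNorm_neg]))
      simp only [map_add, map_neg] at this
      linarith
    have h3 : P.b (P.v y) = P.b q + P.b ystar - P.b y := by
      rw [hqd]; simp
    rw [map_add, map_smul, smul_eq_mul, h3] at h1
    have h4 := mul_le_mul_of_nonneg_left h2 ha
    have h5 : (P.b ystar - P.b y) * (abar - 1) ≤ (P.b ystar - P.b y) * (abar * δ) := by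
      linarith
    exact le_of_mul_le_mul_left h5 hgap

include hbound in
/-- The norm of the residual after a predictor step. -/
lemma opDualNorm_residual_le {α : ℝ} (hα : 0 ≤ α) (hα' : α < abar) :
    opDualNorm (hess P.f y) (grad P.f (y + α • P.v y) - (xi abar α / μ) • P.b) ≤
      |abar / (abar - α) - xi abar α| * √P.ν +
        abar / (abar - α) * (α / (abar - α)) * (kappa1 P.ν / γd * μ) *
          ((σd + 6 / 25 * P.ν ^ 2) * √P.ν + kappa P.ν γd σd * μ / 2 * (1 + abar * √P.ν) *
            (25 / 24 * (2 * P.ν * μ⁻¹))) +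
        xi abar α * (μ / 25) := by
  have hs := hP.slack_mem_interior hy.1
  have hs1 := hP.central_mem_interior (μ := 1) one_pos
  have hν := hP.nu_nonneg
  have hq := hP.opNorm_predictor_sub_le hμ hμ1 hy hystar hbound hsharp
  have habar := hP.abs_maxStep_sub_one_le hμ hμ1 hy hystar hbound hsharp hstep
  set δ := kappa P.ν γd σd * μ / 2
  set S := σd + 6 / 25 * P.ν ^ 2 with hSd
  set s := P.slack y with hsd
  set s1 := (P.centralPath 1).2.1 with hs1d
  set sbar := P.slack (y + abar • P.v y) with hsbar
  set ξ := xi abar α with hξ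
  have hsbarmem : sbar ∈ P.Kd := hstep.1.2
  have ha : 0 < abar := hα.trans_lt hα'
  have hd : 0 < abar - α := by linarith
  set τ := α / (abar - α) with hτ
  set θ := abar / (abar - α) with hθ
  have hτ0 : 0 ≤ τ := div_nonneg hα hd.le
  have hθ0 : 0 < θ := div_pos ha hd
  have hS : 0 ≤ S := by have := sigma_nonneg hbound; positivity
  have hδ : 0 ≤ δ := (opNorm_nonneg _ _).trans hq
  have hκ1 : 0 ≤ kappa1 P.ν / γd := by
    have := hsharp.1
    unfold kappa1; positivity
  have hξ1 : 1 ≤ ξ := one_le_xi hα hα'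
  have hτs := isCone_Kd.smul_mem τ hτ0 _ hsbarmem
  have hmid := isCone_Kd.add_mem_interior hs hτs
  -- The new point is a convex combination of y and the end of the maximal step. Pulling out θ = 1 +
  -- τ leaves a displacement τs̄ inside K^*, to which negative curvature applies.
  have hslack : P.slack (y + α • P.v y) = θ⁻¹ • (s + τ • sbar) := by
    rw [eq_inv_smul_iff₀ hθ0.ne', hsbar, slack_add_smul, slack_add_smul, ← hsd, smul_add,
      smul_add, smul_smul, smul_smul, ← add_assoc]
    have e1 : θ = 1 + τ := by rw [hθ, hτ]; field_simp; ring
    have e2 : θ * α = τ * abar := by rw [hθ, hτ]; ring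
    rw [e2, e1, add_smul, one_smul]
  have hnew : P.slack (y + α • P.v y) ∈ interior P.Kd := by
    rw [hslack]; exact isCone_Kd.smul_mem_interior hmid (inv_pos.2 hθ0)
  -- s̄ is replaced by s_*, at local distance ‖q + (`abar` - 1)v‖_y ≤ δ(1 + `abar`√ν).
  have hlin : P.M s sbar s1 ≤ S * √P.ν + δ * (1 + abar * √P.ν) * (25 / 24 * (2 * P.ν * μ⁻¹)) := by
    have e1 : P.M s sbar s1 = P.M s (P.slack ystar) s1 + P.M s (sbar - P.slack ystar) s1 := by
      rw [map_sub, sub_apply]; ring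
    have e2 := (le_abs_self _).trans (hP.abs_M_slack_star_le hμ hμ1 hy hystar hbound s1)
    rw [hP.opNorm_M_self hs1, ← hsd, ← hSd] at e2
    have e3 := (hP.isPSD_M hs).apply_le (sbar - P.slack ystar) s1
    have e4 : opNorm (P.M s) s1 ≤ 25 / 24 * (2 * P.ν * μ⁻¹) :=
      (hP.opNorm_le_of_mem hs (interior_subset hs1)).trans (hP.central_one_apply_X_le hμ hμ1 hy)
    have e5 : opNorm (P.M s) (sbar - P.slack ystar) ≤ δ * (1 + abar * √P.ν) := by
      rw [← neg_sub, opNorm_neg, hsbar, ← Aadj_sub_eq, ← hP.opNorm_hess_f hs]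
      have e6 : y + abar • P.v y - ystar = (y + P.v y - ystar) + (abar - 1) • P.v y := by module
      rw [e6]
      refine ((hP.isPSD_hess_f hs).opNorm_add_le _ _).trans ?_
      rw [opNorm_smul]
      have := mul_le_mul habar (hP.opNorm_v_le hs) (opNorm_nonneg _ _) (by positivity)
      linarith
    have e7 := mul_le_mul e5 e4 (opNorm_nonneg _ _) (by positivity)
    linarith
  set W := S * √P.ν + δ * (1 + abar * √P.ν) * (25 / 24 * (2 * P.ν * μ⁻¹)) with hW
  have hW0 : 0 ≤ W := by positivity
  refine opDualNorm_le_of_forall (hP.hess_f_pos hs) (by positivity) fun h => ?_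
  have hr0 := opNorm_nonneg (hess P.f y) h
  set u := P.Aadj h with hu
  set e := u (P.X s) - u (P.X (s + τ • sbar)) with he
  have hebd : |e| ≤ kappa1 P.ν / γd * μ * opNorm (hess P.f y) h * (τ * W) := by
    -- Both ‖u‖s₁ ± u lie in K^*. Monotonicity of -∇F_* on each dominates |e| by ‖u‖ times the
    -- decrease measured by s₁, which the initial rate ⟨∇²F_*(s)s̄, s₁⟩ bounds.
    have f1 := hP.X_add_le hs hτs (hP.smul_add_mem hs1 (u := u) le_rfl)
    have f2 := hP.X_add_le hs hτs (hP.smul_sub_mem hs1 (u := u) le_rfl)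
    have f3 := hP.X_sub_le hs hτs (interior_subset hs1)
    rw [map_smul, smul_apply, smul_eq_mul] at f3
    have f4 := hP.opNorm_G_le hμ hμ1 hy hystar hsharp h
    rw [hP.opNorm_G] at f4
    simp only [add_apply, sub_apply, smul_apply, smul_eq_mul] at f1 f2
    have f5 : opNorm (P.M s1) u * (s1 (P.X s) - s1 (P.X (s + τ • sbar))) ≤
        kappa1 P.ν / γd * μ * opNorm (hess P.f y) h * (τ * W) :=
      (mul_le_mul_of_nonneg_left (f3.trans (mul_le_mul_of_nonneg_left hlin hτ0))
        (opNorm_nonneg _ _)).trans (mul_le_mul_of_nonneg_right f4 (by positivity))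
    rw [abs_le]
    constructor <;> linarith
  have hg1 : grad P.f (y + α • P.v y) h = θ * (grad P.f y h - e) := by
    rw [hP.grad_f hnew, hP.grad_f hs, hslack, hP.X_smul hmid (inv_pos.2 hθ0), inv_inv, map_smul,
      smul_eq_mul, he]
    ring
  have hε := hP.abs_grad_sub_le hy h
  have hg := hP.abs_grad_f_le hs h
  set ε := grad P.f y h - μ⁻¹ * P.b h with hεd
  -- Three sources of error: the mismatch of θ and ξ, curvature along the step, and the centering
  -- error at y scaled by ξ.
  have hfin : (grad P.f (y + α • P.v y) - (ξ / μ) • P.b) h =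
      (θ - ξ) * grad P.f y h + -(θ * e) + ξ * ε := by
    rw [sub_apply, smul_apply, hg1, smul_eq_mul, hεd]
    ring
  rw [hfin]
  have b1 : (θ - ξ) * grad P.f y h ≤ |θ - ξ| * (√P.ν * opNorm (hess P.f y) h) := by
    refine (le_abs_self _).trans ?_
    rw [abs_mul]
    exact mul_le_mul_of_nonneg_left hg (abs_nonneg _)
  have b2 : -(θ * e) ≤ θ * (kappa1 P.ν / γd * μ * opNorm (hess P.f y) h * (τ * W)) := by
    rw [← mul_neg]
    exact mul_le_mul_of_nonneg_left ((neg_le_abs _).trans hebd) hθ0.le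
  have b3 : ξ * ε ≤ ξ * (μ / 25 * opNorm (hess P.f y) h) :=
    mul_le_mul_of_nonneg_left ((le_abs_self _).trans hε) (by linarith)
  linarith

end Near

end IsStandard

end ConicProblem

/-! ### Estimates of the constants -/

lemma kappa1_nonneg {ν : ℝ} (hν : 0 ≤ ν) : 0 ≤ kappa1 ν := by unfold kappa1; positivity

lemma kappa_nonneg {ν γd σd : ℝ} (hν : 0 ≤ ν) (hγ : 0 < γd) (hσ : 0 ≤ σd) :
    0 ≤ kappa ν γd σd := by
  have := kappa1_nonneg hν
  rw [kappa_eq]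
  positivity

lemma c0_eq (ν γd σd : ℝ) : c0 ν γd σd = kappa ν γd σd * √ν + kappa ν γd σd +
    2 * (kappa1 ν / γd) * (2 * kappa ν γd σd * ν * (1 + 2 * √ν) * (24 / 23)) := by
  rw [c0]
  conv_rhs => enter [1, 2]; rw [kappa_eq]
  ring

lemma kappa_le_c0 {ν γd σd : ℝ} (hν : 0 ≤ ν) (hγ : 0 < γd) (hσ : 0 ≤ σd) :
    kappa ν γd σd ≤ c0 ν γd σd := by
  have h1 := kappa1_nonneg hν
  have h2 := kappa_nonneg hν hγ hσ
  rw [c0_eq, add_right_comm]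
  exact le_add_of_nonneg_left (by positivity)

/-- The threshold gives 9κμ ≤ 9c₀μ ≤ 1/6. This is the only role of the threshold: it makes δ = κμ/2
small enough for the numerical constants below. -/
lemma kappa_mul_le_of_le_threshold {ν γd σd μ : ℝ} (hν : 0 ≤ ν) (hγ : 0 < γd) (hσ : 0 ≤ σd)
    (hμ0 : 0 < μ) (hμ : μ ≤ threshold ν γd σd) : kappa ν γd σd * μ / 2 ≤ 1 / 100 := by
  have h1 := kappa_le_c0 hν hγ hσ
  have h2 := kappa_nonneg hν hγ hσ
  set c := c0 ν γd σd
  have hc : 0 ≤ c := h2.trans h1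
  have hs := Real.sqrt_nonneg ν
  rw [threshold, betaTol, le_div_iff₀ (by positivity)] at hμ
  have h3 : kappa ν γd σd * μ ≤ c * μ := mul_le_mul_of_nonneg_right h1 hμ0.le
  have h4 : 0 ≤ μ * (2 * √ν) * (9 * c + 7 / 25) := by positivity
  nlinarith

/-! ### One iteration of the method -/

namespace ConicProblem

variable {E H : Type*} [NormedAddCommGroup E] [NormedSpace ℝ E]
  [NormedAddCommGroup H] [NormedSpace ℝ H] {P : ConicProblem E H}

namespace IsStandard

variable [FiniteDimensional ℝ E] [FiniteDimensional ℝ H] (hP : P.IsStandard)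
include hP

variable {μ : ℝ} (hμ : 0 < μ) (hμ1 : μ ≤ 1) {y : H} (hy : y ∈ P.nbhd μ (μ / 25))
include hμ hy

include hμ1 in
/-- Near the solution, the proximity measure grows at most quadratically with the predicted
decrease of the penalty parameter. -/
lemma Gam_le {ystar : H} (hystar : P.IsDualOptimal ystar) {γd σd : ℝ}
    (hbound : P.BoundedHessianAlongPath ystar σd) (hsharp : P.SharpDualMaximum ystar γd)
    {abar : ℝ} (hstep : P.IsMaxStep y abar) (hsmall : kappa P.ν γd σd * μ / 2 ≤ 1 / 100)
    {α : ℝ} (hα : 0 ≤ α) (hα' : α < abar) :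
    P.Gam abar μ y α ≤ (1 + 2 * √P.ν) *
      (μ * (11 / 10 * c0 P.ν γd σd * xi abar α ^ 2 + xi abar α / 25)) := by
  have hν := hP.nu_nonneg
  have hs := hP.slack_mem_interior hy.1
  have hσ := sigma_nonneg hbound
  have hκ := kappa_nonneg hν hsharp.1 hσ
  have habar := hP.abs_maxStep_sub_one_le hμ hμ1 hy hystar hbound hsharp hstep
  have hres := hP.opDualNorm_residual_le hμ hμ1 hy hystar hbound hsharp hstep hα hα'
  have hκeq := kappa_eq P.ν γd σd
  have hg : 0 ≤ kappa1 P.ν / γd := div_nonneg (kappa1_nonneg hν) hsharp.1.le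
  have hS : 0 ≤ σd + 6 / 25 * P.ν ^ 2 := by positivity
  have hξ1 := one_le_xi hα hα'
  rw [c0_eq]
  set κ := kappa P.ν γd σd
  set g := kappa1 P.ν / γd
  set S := σd + 6 / 25 * P.ν ^ 2
  set q := √P.ν with hq
  have hq0 : 0 ≤ q := Real.sqrt_nonneg _
  set ξ := xi abar α with hξ
  have ha : 0 < abar := hα.trans_lt hα'
  have hd : 0 < abar - α := by linarith
  set δ := κ * μ / 2 with hδ
  have hδ0 : 0 ≤ δ := by positivity
  have ha2 : abar ≤ 2 := by
    have h1 := (abs_le.1 habar).2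
    have h2 := mul_le_mul_of_nonneg_left hsmall ha.le
    linarith
  have ha1 : 1 ≤ abar * (1 + δ) := by linarith [(abs_le.1 habar).1]
  set τ := α / (abar - α) with hτ
  set θ := abar / (abar - α) with hθ
  have hτ0 : 0 ≤ τ := div_nonneg hα hd.le
  have hθ0 : 0 ≤ θ := div_nonneg ha.le hd.le
  have hξτ : ξ = 1 + abar * τ := by rw [hξ, xi, hτ]; ring
  have hθξ : |θ - ξ| ≤ δ * ξ := by
    have e1 : θ - ξ = -(τ * (abar - 1)) := by
      have : θ = 1 + τ := by rw [hθ, hτ]; field_simp; ring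
      rw [this, hξτ]; ring
    rw [e1, abs_neg, abs_mul, abs_of_nonneg hτ0]
    have := mul_le_mul_of_nonneg_left habar hτ0
    rw [hξτ]
    linarith
  have hθ1 : θ ≤ (1 + δ) * ξ := by linarith [(abs_le.1 hθξ).2]
  have hτ1 : τ ≤ (1 + δ) * ξ := by
    have := mul_le_mul_of_nonneg_right ha1 hτ0
    rw [hξτ]
    linarith
  -- Both θ and τ are at most (1+δ)ξ, and (1 + 1/100)² ≤ 11/10. This product is the origin of the
  -- quadratic dependence on ξ.
  have hθτ : θ * τ ≤ 11 / 10 * ξ ^ 2 := by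
    have h1 := mul_le_mul hθ1 hτ1 hτ0 (by positivity)
    have h2 : (1 + δ) ^ 2 ≤ 11 / 10 := by nlinarith
    have h3 := mul_le_mul_of_nonneg_right h2 (sq_nonneg ξ)
    linarith
  have hW : S * q + δ * (1 + abar * q) * (25 / 24 * (2 * P.ν * μ⁻¹)) ≤
      S * q + κ * (1 + 2 * q) * (25 / 24 * P.ν) := by
    -- The factor μ in δ cancels the μ⁻¹ from the comparison of norms, so this bracket is bounded
    -- uniformly in μ.
    have h1 : δ * (1 + abar * q) * (25 / 24 * (2 * P.ν * μ⁻¹)) =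
        κ * (1 + abar * q) * (25 / 24 * P.ν) := by rw [hδ]; field_simp
    rw [h1]
    gcongr
  have hres2 : opDualNorm (hess P.f y) (grad P.f (y + α • P.v y) - (ξ / μ) • P.b) ≤
      μ * (11 / 10 * (κ * q + κ + 2 * g * (2 * κ * P.ν * (1 + 2 * q) * (24 / 23))) * ξ ^ 2 +
        ξ / 25) := by
    refine hres.trans ?_
    have b1 := mul_le_mul_of_nonneg_right hθξ hq0
    have b2 : θ * τ * (g * μ) * (S * q + δ * (1 + abar * q) * (25 / 24 * (2 * P.ν * μ⁻¹))) ≤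
        11 / 10 * ξ ^ 2 * (g * μ) * (S * q + κ * (1 + 2 * q) * (25 / 24 * P.ν)) :=
      mul_le_mul (mul_le_mul_of_nonneg_right hθτ (by positivity)) hW (by positivity)
        (by positivity)
    have b3 : g * S = κ / 2 := by rw [hκeq]; ring
    have b4 : 11 / 10 * ξ ^ 2 * (g * μ) * (S * q + κ * (1 + 2 * q) * (25 / 24 * P.ν)) =
        μ * (11 / 10 * ξ ^ 2 * (κ / 2 * q + 25 / 24 * (g * κ * P.ν * (1 + 2 * q)))) := by
      rw [← b3]; ring
    have b5 : δ * ξ * q ≤ μ * (κ * q * ξ ^ 2 / 2) := by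
      have : ξ ≤ ξ ^ 2 := by nlinarith
      have := mul_le_mul_of_nonneg_left this (by positivity : 0 ≤ κ * q * μ / 2)
      rw [hδ]; linarith
    have b6 : μ * (κ * q * ξ ^ 2 / 2) +
        μ * (11 / 10 * ξ ^ 2 * (κ / 2 * q + 25 / 24 * (g * κ * P.ν * (1 + 2 * q)))) ≤
        μ * (11 / 10 * (κ * q + κ + 2 * g * (2 * κ * P.ν * (1 + 2 * q) * (24 / 23))) * ξ ^ 2) := by
      rw [← mul_add]
      refine mul_le_mul_of_nonneg_left ?_ hμ.le
      have p1 : 0 ≤ κ * q * ξ ^ 2 := by positivity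
      have p2 : 0 ≤ κ * ξ ^ 2 := by positivity
      have p3 : 0 ≤ g * κ * P.ν * (1 + 2 * q) * ξ ^ 2 := by positivity
      linarith
    rw [b4] at b2
    linarith
  refine mul_le_mul ?_ hres2 (Real.sqrt_nonneg _) (by positivity)
  have h1 := mul_le_mul_of_nonneg_left (hP.coneMeasure_v_le hs) hα
  have h2 := mul_le_mul_of_nonneg_right (hα'.le.trans ha2) hq0
  linarith

omit [FiniteDimensional ℝ H] in
/-- One iteration does not increase the penalty parameter and keeps the iterates near the
central path. -/
lemma iteration_mem {μ' : ℝ} {y' : H} (hit : P.Iteration μ y μ' y') :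
    0 < μ' ∧ μ' ≤ μ ∧ y' ∈ P.nbhd μ' (μ' / 25) := by
  obtain ⟨abar, i, hstep, -, -, rfl, -, hy'⟩ := hit
  have hs := hP.slack_mem_interior hy.1
  have ht := hP.trial_mem hs hstep i
  have hξ := one_le_xi ht.1 ht.2
  exact ⟨by positivity, div_le_self hμ.le hξ, hy'⟩

include hμ1 in
-- The upper bound on Γ at the rejected successor forces its ξ to be large, and the fourfold growth
-- bound passes this back to the accepted ξ = x: c₁ ≤ (9x)²μ. Then μ/x ≤ 9μ√μ/√c₁.
lemma iteration_le {ystar : H} (hystar : P.IsDualOptimal ystar) {γd σd : ℝ}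
    (hbound : P.BoundedHessianAlongPath ystar σd) (hsharp : P.SharpDualMaximum ystar γd)
    (hthr : μ ≤ threshold P.ν γd σd) {μ' : ℝ} {y' : H} (hit : P.Iteration μ y μ' y') :
    μ' ≤ 9 / √(c1 P.ν γd σd) * μ ^ (3 / 2 : ℝ) := by
  obtain ⟨abar, i, hstep, -, hrej, rfl, -, -⟩ := hit
  have hs := hP.slack_mem_interior hy.1
  have hν := hP.nu_nonneg
  have hσ := sigma_nonneg hbound
  have ht := hP.trial_mem hs hstep i
  have ht' := hP.trial_mem hs hstep (i + 1)
  have hsucc : P.trial abar y (i + 1) = eta abar (P.trial abar y i) := by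
    simp only [trial, Function.iterate_succ_apply']
  have hG := hrej.trans_le (hP.Gam_le hμ hμ1 hy hystar hbound hsharp hstep
    (kappa_mul_le_of_le_threshold hν hsharp.1 hσ hμ hthr) ht'.1 ht'.2)
  have hx1 := one_le_xi ht.1 ht.2
  have hz1 := one_le_xi ht'.1 ht'.2
  have hzx := xi_eta_le ht.1 ht.2
  rw [← hsucc] at hzx
  have hc0 : 0 ≤ c0 P.ν γd σd := (kappa_nonneg hν hsharp.1 hσ).trans (kappa_le_c0 hν hsharp.1 hσ)
  set x := xi abar (P.trial abar y i)
  set z := xi abar (P.trial abar y (i + 1))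
  set q := √P.ν
  have hq0 : 0 ≤ q := Real.sqrt_nonneg _
  have hc1 : c1 P.ν γd σd ≤ (9 * x) ^ 2 * μ := by
    rw [c1, betaTol, div_le_iff₀ (by positivity)]
    rw [betaTol] at hG
    have h1 : z ^ 2 ≤ (4 * x) ^ 2 := pow_le_pow_left₀ (by linarith) hzx 2
    -- With z ≤ 4x and x ≥ 1, the factor 9 suffices because (11/10)·16 ≤ 81 and 4/25 ≤ 81·7/225.
    have h2 : 11 / 10 * c0 P.ν γd σd * z ^ 2 + z / 25 ≤
        (9 * x) ^ 2 * (c0 P.ν γd σd + 7 / (9 * 25)) := by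
      have e1 := mul_le_mul_of_nonneg_left h1 (by positivity : 0 ≤ 11 / 10 * c0 P.ν γd σd)
      have e2 : 0 ≤ c0 P.ν γd σd * x ^ 2 := by positivity
      have e3 : x ≤ x ^ 2 := by nlinarith
      nlinarith
    have h3 := mul_le_mul_of_nonneg_left h2 (by positivity : 0 ≤ (1 + 2 * q) * μ)
    linarith
  have hc1pos : 0 < c1 P.ν γd σd := by unfold c1 betaTol; positivity
  have hsq : √(c1 P.ν γd σd) ≤ 9 * x * √μ := by
    rw [← Real.sqrt_sq (by positivity : 0 ≤ 9 * x), ← Real.sqrt_mul (by positivity)]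
    exact Real.sqrt_le_sqrt hc1
  have hpow : μ ^ (3 / 2 : ℝ) = μ * √μ := by
    rw [Real.sqrt_eq_rpow, ← Real.rpow_one_add' hμ.le (by norm_num)]
    norm_num
  have hc1s := Real.sqrt_pos.2 hc1pos
  rw [hpow, div_mul_eq_mul_div, div_le_div_iff₀ (by positivity) hc1s]
  have := mul_le_mul_of_nonneg_left hsq hμ.le
  linarith

end IsStandard

end ConicProblem

end DualPathFollowing

end

theorem mainTheorem1 {E H : Type*}
    [NormedAddCommGroup E] [NormedSpace ℝ E] [FiniteDimensional ℝ E]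
    [NormedAddCommGroup H] [NormedSpace ℝ H] [FiniteDimensional ℝ H]
    (P : DualPathFollowing.ConicProblem E H)
    (hK : DualPathFollowing.IsRegularCone P.K)
    (hF : DualPathFollowing.IsNormalBarrier (P.K : Set E) P.F P.ν)
    (hA : Function.Surjective P.A)
    (hfeas : P.StrictlyFeasible)
    (hcurv : DualPathFollowing.HasNegativeCurvature P.Kd P.Fd)
    (ystar : H) (hystar : P.IsDualOptimal ystar)
    (γd : ℝ) (hsharp : P.SharpDualMaximum ystar γd)
    (σd : ℝ) (hbound : P.BoundedHessianAlongPath ystar σd)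
    (μ : ℕ → ℝ) (y : ℕ → H) (k : ℕ) (hrun : P.GeneratedUpTo k μ y)
    (hμ : μ k ≤ DualPathFollowing.threshold P.ν γd σd) :
    μ (k + 1) ≤ 9 / √(DualPathFollowing.c1 P.ν γd σd) * (μ k) ^ (3 / 2 : ℝ) := by
  have hP : P.IsStandard := ⟨hK, hF, hA, hfeas, hcurv⟩
  obtain ⟨h0, hy0, hit⟩ := hrun
  -- The corrector's tolerance μ/25 is the invariant of the iterates; at μ₀ = 1 it coincides with
  -- the initial condition.
  have key : ∀ j ≤ k, 0 < μ j ∧ μ j ≤ 1 ∧ y j ∈ P.nbhd (μ j) (μ j / 25) := by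
    intro j
    induction j with
    | zero => exact fun _ => ⟨by rw [h0]; exact one_pos, h0.le, by rw [h0]; exact hy0⟩
    | succ j ih =>
      intro hj
      obtain ⟨hp, h1, hy⟩ := ih (by omega)
      obtain ⟨hp', hle, hy'⟩ := hP.iteration_mem hp hy (hit j (by omega))
      exact ⟨hp', hle.trans h1, hy'⟩
  obtain ⟨hp, h1, hy⟩ := key k le_rfl
  exact hP.iteration_le hp h1 hy hystar hbound hsharp hμ (hit k le_rfl)
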